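/- Let $M$ be an $n$-dimensional complex manifold with a hermitian metric $\omega$ and let $E\to M$ be a holomorphic vector bundle of rank $r$. A \emph{measurable metric} on $E$ is a section $h$ of $E^*\otimes\bar E^*$ with measurable coefficients which is almost everywhere a positive definite hermitian form. A \emph{singular hermitian metric} $(M,E,\Sigma,M_j,h,h_{j,s})$ consists of a measurable metric $h$, a closed set $\Sigma\subset M$ of measure zero, relatively compact open sets $M_1\Subset M_2\Subset\cdots$ with $\bigcup_j M_j=M$, and, for each $j$, hermitian metrics $h_{j,s}$ ($s\ge 1$) of class $C^2$ on $E|_{M_j}$ with $\lim_{s\to\infty}h_{j,s}=h$ pointwise on $M_j\setminus\Sigma$. It is \emph{singular Nakano semi-positive} if for each $j$ there are continuous functions $\lambda_{j,s}$ ($s\ge1$) and $\lambda_j$ on $\overline{M_j}$ such that (1) $|e|_{h_{j,s}}\le |e|_{h_{j,s+1}}$ for all $x\in M_j$, $e\in E_x$ and $s$; (2) $\Theta_{h_{j,s}}(E)\ge_{Nak}-\lambda_{j,s}\,\omega\otimes \mathrm{Id}_E$ on $M_j$ for all $s$, where $\Theta_{h_{j,s}}(E)$ is the Chern curvature and $\ge_{Nak}$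 is inequality of hermitian forms on $TM\otimes E$; (3) $\lambda_{j,s}\to0$ almost everywhere on $M_j$ as $s\to\infty$; (4) $0\le\lambda_{j,s}\le\lambda_j$ on $M_j$ for all $s$. A measurable metric $h$ is \emph{singular Griffiths semi-positive} if it is positive definite at every point and $|u|^2_{h^*}$ is plurisubharmonic on $U$ for every open $U\subset M$ and every holomorphic section $u$ of $E^*$ over $U$, where $h^*$ is the dual metric. Let $(M,E,\Sigma,M_j,h,h_{j,s})$ be singular Nakano semi-positive. (a) If the approximations converge to $h$ also on $\Sigma$, i.e. for every $x\in\Sigma$ there is a $j$ with $x\in M_j$ and $h_{j,s}(x)\to h(x)$ as $s\to\infty$, then $h$ is singular Griffiths semi-positive. (b) Without this condition, for every open $U\subset M$ and every holomorphic section $u$ of $E^*$ over $U$ there is a (real-valued) plurisubharmonic function $f$ on $U$ such that $f=|u|^2_{h^*}$ on $U\setminus\Sigma$ and $f(x)=\lim_{s\to\infty}|u(x)|^2_{h_{j,s}^*}$ for every $j$ and every $x\in U\cap M_j$. -/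

import Mathlib

open Bundle Set Filter Topology MeasureTheory
open scoped Manifold ContDiff ComplexConjugate

noncomputable section

/-! ### Hermitian forms on a complex vector space -/

/-- Sesquilinear forms, conjugate-linear in the first and linear in the second variable. -/
abbrev SesqForm (V : Type*) [AddCommGroup V] [Module ℂ V] : Type _ :=
  V →ₗ⋆[ℂ] V →ₗ[ℂ] ℂ

/-- The form `h` is hermitian and positive definite. -/
def SesqForm.IsPosDef {V : Type*} [AddCommGroup V] [Module ℂ V] (h : SesqForm V) : Prop :=
  (∀ v w : V, conj (h v w) = h w v) ∧ ∀ v : V, v ≠ 0 → 0 < (h v v).re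

/-- The squared norm `|v|²_h = h(v, v)`. -/
def SesqForm.normSq {V : Type*} [AddCommGroup V] [Module ℂ V] (h : SesqForm V) (v : V) : ℝ :=
  (h v v).re

/-- The squared norm `|ξ|²_{h*}` of a linear functional for the dual metric `h*` of a positive
definite hermitian form `h`: the supremum of `|ξ(v)|² / |v|²_h` (the vector `0` contributes
`0 / 0 = 0`). -/
def SesqForm.dualNormSq {V : Type*} [AddCommGroup V] [Module ℂ V] [TopologicalSpace V]
    (h : SesqForm V) (ξ : V →L[ℂ] ℂ) : ℝ :=
  ⨆ v : V, ‖ξ v‖ ^ 2 / h.normSq v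

/-! ### Wirtinger derivatives on `ℂⁿ` -/

/-- `∂f/∂z_j`. -/
def wirtinger {n : ℕ} (j : Fin n) (f : (Fin n → ℂ) → ℂ) (z : Fin n → ℂ) : ℂ :=
  (1 / 2 : ℂ) * (fderiv ℝ f z (Pi.single j 1) - Complex.I * fderiv ℝ f z (Pi.single j Complex.I))

/-- `∂f/∂z̄_j`. -/
def wirtingerBar {n : ℕ} (j : Fin n) (f : (Fin n → ℂ) → ℂ) (z : Fin n → ℂ) : ℂ :=
  (1 / 2 : ℂ) * (fderiv ℝ f z (Pi.single j 1) + Complex.I * fderiv ℝ f z (Pi.single j Complex.I))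

/-- `∂A/∂z_j` for a matrix-valued function, entry by entry. -/
def wirtingerMat {n r : ℕ} (j : Fin n) (A : (Fin n → ℂ) → Matrix (Fin r) (Fin r) ℂ)
    (z : Fin n → ℂ) : Matrix (Fin r) (Fin r) ℂ :=
  Matrix.of fun a b => wirtinger j (fun w => A w a b) z

/-- `∂A/∂z̄_j` for a matrix-valued function, entry by entry. -/
def wirtingerBarMat {n r : ℕ} (j : Fin n) (A : (Fin n → ℂ) → Matrix (Fin r) (Fin r) ℂ)
    (z : Fin n → ℂ) : Matrix (Fin r) (Fin r) ℂ :=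
  Matrix.of fun a b => wirtingerBar j (fun w => A w a b) z

/-- The coefficient `Θ_{j k̄}` (an endomorphism of `ℂʳ`) of the Chern curvature
`Θ = ∂̄(H⁻¹ ∂H) = ∑ Θ_{j k̄} dz_j ∧ dz̄_k` of the metric `|s|² = s* H s` on the trivial bundle of
rank `r` over an open set of `ℂⁿ`, that is `Θ_{j k̄} = -∂/∂z̄_k (H⁻¹ ∂H/∂z_j)`. -/
def chernCurvature {n r : ℕ} (H : (Fin n → ℂ) → Matrix (Fin r) (Fin r) ℂ) (j k : Fin n)
    (z : Fin n → ℂ) : Matrix (Fin r) (Fin r) ℂ :=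
  -wirtingerBarMat k (fun w => (H w)⁻¹ * wirtingerMat j H w) z

/-! ### Complex manifolds: null sets and plurisubharmonic functions

An `n`-dimensional complex manifold is a manifold modelled on `ℂⁿ = Fin n → ℂ`, analytic over
`ℂ`.  Only its local charts enter the next two definitions. -/

section Manifold

variable {n : ℕ} {M : Type*} [TopologicalSpace M] [ChartedSpace (Fin n → ℂ) M]

/-- `S` has Lebesgue measure zero in every coordinate chart. -/
def IsNullSet (n : ℕ) {M : Type*} [TopologicalSpace M] [ChartedSpace (Fin n → ℂ) M]
    (S : Set M) : Prop :=
  ∀ x₀ : M, volume (chartAt (Fin n → ℂ) x₀ '' (S ∩ (chartAt (Fin n → ℂ) x₀).source)) = 0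

/-- A real-valued function `f` is plurisubharmonic on the open set `U`: it is upper semicontinuous
on `U` and, in local coordinates, its restriction to each complex line is subharmonic, i.e. it
satisfies the sub-mean value inequality on all sufficiently small circles around every point.  (For
a real-valued function, the circle means, which could a priori be `-∞`, have to be finite.) -/
def IsPlurisubharmonicOn (n : ℕ) {M : Type*} [TopologicalSpace M] [ChartedSpace (Fin n → ℂ) M]
    (f : M → ℝ) (U : Set M) : Prop :=
  UpperSemicontinuousOn f U ∧
  ∀ x₀ : M, ∀ x ∈ U ∩ (chartAt (Fin n → ℂ) x₀).source, ∀ v : Fin n → ℂ,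
    ∀ᶠ ρ : ℝ in 𝓝[>] 0,
      CircleIntegrable
        (fun ζ : ℂ => f ((chartAt (Fin n → ℂ) x₀).symm (chartAt (Fin n → ℂ) x₀ x + ζ • v))) 0 ρ ∧
      f x ≤ Real.circleAverage
        (fun ζ : ℂ => f ((chartAt (Fin n → ℂ) x₀).symm (chartAt (Fin n → ℂ) x₀ x + ζ • v))) 0 ρ

end Manifold

/-! ### Metrics on vector bundles -/

section Bundle

variable {n r : ℕ} {M : Type*} [TopologicalSpace M] [ChartedSpace (Fin n → ℂ) M]
  {E : M → Type*} [TopologicalSpace (TotalSpace (Fin r → ℂ) E)]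
  [∀ x, AddCommGroup (E x)] [∀ x, Module ℂ (E x)] [∀ x, TopologicalSpace (E x)]
  [FiberBundle (Fin r → ℂ) E]

/-- The part, in the coordinates of the chart at `x₀`, of the set `A` over which the bundle is
trivialized by the trivialization at `x₁`. -/
def coordDomain (n r : ℕ) {M : Type*} [TopologicalSpace M] [ChartedSpace (Fin n → ℂ) M]
    (E : M → Type*) [TopologicalSpace (TotalSpace (Fin r → ℂ) E)] [∀ x, TopologicalSpace (E x)]
    [FiberBundle (Fin r → ℂ) E] (A : Set M) (x₀ x₁ : M) : Set (Fin n → ℂ) :=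
  (chartAt (Fin n → ℂ) x₀).target ∩
    (chartAt (Fin n → ℂ) x₀).symm ⁻¹' (A ∩ (trivializationAt (Fin r → ℂ) E x₁).baseSet)

/-- The matrix `H_{a b} = h(e_a, e_b)` of a field of sesquilinear forms on `E`, in the frame
`e_1, …, e_r` of the trivialization at `x₁` and the coordinates of the chart at `x₀`. -/
def localMatrix (h : ∀ x, SesqForm (E x)) (x₀ x₁ : M) (z : Fin n → ℂ) :
    Matrix (Fin r) (Fin r) ℂ :=
  Matrix.of fun a b =>
    h ((chartAt (Fin n → ℂ) x₀).symm z)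
      ((trivializationAt (Fin r → ℂ) E x₁).symm ((chartAt (Fin n → ℂ) x₀).symm z) (Pi.single a 1))
      ((trivializationAt (Fin r → ℂ) E x₁).symm ((chartAt (Fin n → ℂ) x₀).symm z) (Pi.single b 1))

/-- `h` is a hermitian metric of class `C^k` (in the real sense) on the restriction of `E` to the
open set `A`. -/
def IsHermitianMetricOn (n r : ℕ) {M : Type*} [TopologicalSpace M] [ChartedSpace (Fin n → ℂ) M]
    {E : M → Type*} [TopologicalSpace (TotalSpace (Fin r → ℂ) E)]
    [∀ x, AddCommGroup (E x)] [∀ x, Module ℂ (E x)] [∀ x, TopologicalSpace (E x)]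
    [FiberBundle (Fin r → ℂ) E]
    (k : WithTop ℕ∞) (h : ∀ x, SesqForm (E x)) (A : Set M) : Prop :=
  (∀ x ∈ A, (h x).IsPosDef) ∧
  ∀ (x₀ x₁ : M) (a b : Fin r),
    ContDiffOn ℝ k (fun z : Fin n → ℂ => localMatrix h x₀ x₁ z a b) (coordDomain n r E A x₀ x₁)

/-- `h` is a measurable metric on `E`: a field of sesquilinear forms with (Lebesgue) measurable
coefficients which is almost everywhere a positive definite hermitian form. -/
def IsMeasurableMetric (n r : ℕ) {M : Type*} [TopologicalSpace M] [ChartedSpace (Fin n → ℂ) M]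
    {E : M → Type*} [TopologicalSpace (TotalSpace (Fin r → ℂ) E)]
    [∀ x, AddCommGroup (E x)] [∀ x, Module ℂ (E x)] [∀ x, TopologicalSpace (E x)]
    [FiberBundle (Fin r → ℂ) E] (h : ∀ x, SesqForm (E x)) : Prop :=
  (∀ (x₀ x₁ : M) (a b : Fin r),
    AEMeasurable (fun z : Fin n → ℂ => localMatrix h x₀ x₁ z a b)
      (volume.restrict (coordDomain n r E univ x₀ x₁))) ∧
  IsNullSet n {x | ¬ (h x).IsPosDef}

/-- `u` is a holomorphic section over `U` of the dual bundle `E*`, which is Mathlib's bundle of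
continuous linear maps from `E` to the trivial line bundle. -/
def IsHolomorphicDualSection (n r : ℕ) {M : Type*} [TopologicalSpace M]
    [ChartedSpace (Fin n → ℂ) M]
    {E : M → Type*} [TopologicalSpace (TotalSpace (Fin r → ℂ) E)]
    [∀ x, AddCommGroup (E x)] [∀ x, Module ℂ (E x)] [∀ x, TopologicalSpace (E x)]
    [FiberBundle (Fin r → ℂ) E] [VectorBundle ℂ (Fin r → ℂ) E]
    (u : ∀ x, E x →L[ℂ] ℂ) (U : Set M) : Prop :=
  ContMDiffOn 𝓘(ℂ, Fin n → ℂ) (𝓘(ℂ, Fin n → ℂ).prod 𝓘(ℂ, (Fin r → ℂ) →L[ℂ] ℂ)) ω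
    (fun x => TotalSpace.mk' ((Fin r → ℂ) →L[ℂ] ℂ)
      (E := fun x => E x →L[ℂ] Trivial M ℂ x) x (u x)) U

/-- `h` is singular Griffiths semi-positive: `h` is a measurable metric which is positive definite
everywhere, and `|u|²_{h*}` is plurisubharmonic for every local holomorphic section `u` of `E*`. -/
def IsGriffithsSemipositive (n r : ℕ) {M : Type*} [TopologicalSpace M]
    [ChartedSpace (Fin n → ℂ) M]
    {E : M → Type*} [TopologicalSpace (TotalSpace (Fin r → ℂ) E)]
    [∀ x, AddCommGroup (E x)] [∀ x, Module ℂ (E x)] [∀ x, TopologicalSpace (E x)]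
    [FiberBundle (Fin r → ℂ) E] [VectorBundle ℂ (Fin r → ℂ) E]
    (h : ∀ x, SesqForm (E x)) : Prop :=
  IsMeasurableMetric n r h ∧ (∀ x, (h x).IsPosDef) ∧
  ∀ U : Set M, IsOpen U → ∀ u : ∀ x, E x →L[ℂ] ℂ, IsHolomorphicDualSection n r u U →
    IsPlurisubharmonicOn n (fun x => (h x).dualNormSq (u x)) U

/-- `Θ_h(E) ≥_Nak q ⊗ Id_E` on `A`, for a metric `h` of class `C²` on `E` and a field `q` of
hermitian forms on `TM`.  In local coordinates and a local holomorphic frame, this says that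
`∑_{j,k} ⟨Θ_{j k̄} τ_j, τ_k⟩_h ≥ ∑_{j,k} q_{j k̄} ⟨τ_j, τ_k⟩_h` for all `τ_1, …, τ_n` in `ℂʳ`, where
`q(ξ, ξ) = ∑ q_{j k̄} ξ_j ξ̄_k`, i.e. `q_{j k̄} = q(∂_k, ∂_j)`.  (The local frame of `TM` given by
its trivialization at `x₀` is the coordinate frame of the chart at `x₀`.) -/
def NakanoGE (n r : ℕ) {M : Type*} [TopologicalSpace M]
    [ChartedSpace (Fin n → ℂ) M] [IsManifold 𝓘(ℂ, Fin n → ℂ) ω M]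
    {E : M → Type*} [TopologicalSpace (TotalSpace (Fin r → ℂ) E)]
    [∀ x, AddCommGroup (E x)] [∀ x, Module ℂ (E x)] [∀ x, TopologicalSpace (E x)]
    [FiberBundle (Fin r → ℂ) E]
    (h : ∀ x, SesqForm (E x)) (q : ∀ x : M, SesqForm (TangentSpace 𝓘(ℂ, Fin n → ℂ) x))
    (A : Set M) : Prop :=
  ∀ (x₀ x₁ : M), ∀ z ∈ coordDomain n r E A x₀ x₁, ∀ τ : Fin n → Fin r → ℂ,
    (∑ j, ∑ k, localMatrix (r := n) (E := TangentSpace 𝓘(ℂ, Fin n → ℂ)) q x₀ x₀ z k j *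
      (star (τ k) ⬝ᵥ Matrix.mulVec (localMatrix h x₀ x₁ z) (τ j))).re ≤
    (∑ j, ∑ k, star (τ k) ⬝ᵥ
      Matrix.mulVec (localMatrix h x₀ x₁ z * chernCurvature (localMatrix h x₀ x₁) j k z) (τ j)).re

end Bundle

/-! ### Singular hermitian metrics -/

/-- A singular hermitian metric `(M, E, Σ, M_j, h, h_{j,s})` on `E`. The approximating metrics
`h_{j,s}` are only meaningful over `M_j`. -/
structure SingularHermitianMetric (n r : ℕ) {M : Type*} [TopologicalSpace M]
    [ChartedSpace (Fin n → ℂ) M]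
    (E : M → Type*) [TopologicalSpace (TotalSpace (Fin r → ℂ) E)]
    [∀ x, AddCommGroup (E x)] [∀ x, Module ℂ (E x)] [∀ x, TopologicalSpace (E x)]
    [FiberBundle (Fin r → ℂ) E] where
  /-- the exceptional set `Σ` -/
  sing : Set M
  /-- the exhaustion `M_j` -/
  exh : ℕ → Set M
  /-- the metric `h` -/
  metric : ∀ x, SesqForm (E x)
  /-- the approximating metrics `h_{j,s}` -/
  approx : ℕ → ℕ → ∀ x, SesqForm (E x)
  measurable_metric : IsMeasurableMetric n r metric
  isClosed_sing : IsClosed sing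
  sing_null : IsNullSet n sing
  isOpen_exh : ∀ j, IsOpen (exh j)
  isCompact_closure_exh : ∀ j, IsCompact (closure (exh j))
  closure_exh_subset : ∀ j, closure (exh j) ⊆ exh (j + 1)
  iUnion_exh : ⋃ j, exh j = univ
  approx_metric : ∀ j s, IsHermitianMetricOn n r 2 (approx j s) (exh j)
  tendsto_approx : ∀ j, ∀ x ∈ exh j \ sing, ∀ v w : E x,
    Tendsto (fun s => approx j s x v w) atTop (𝓝 (metric x v w))

namespace SingularHermitianMetric

variable {n r : ℕ} {M : Type*} [TopologicalSpace M]
  [ChartedSpace (Fin n → ℂ) M] [IsManifold 𝓘(ℂ, Fin n → ℂ) ω M]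
  {E : M → Type*} [TopologicalSpace (TotalSpace (Fin r → ℂ) E)]
  [∀ x, AddCommGroup (E x)] [∀ x, Module ℂ (E x)] [∀ x, TopologicalSpace (E x)]
  [FiberBundle (Fin r → ℂ) E]

/-- `Θ_h(E) ≥ˢ_Nak θ ⊗ Id_E`, relative to the hermitian metric `g` on `M`. -/
def SingularNakanoGE (S : SingularHermitianMetric n r E)
    (g θ : ∀ x : M, SesqForm (TangentSpace 𝓘(ℂ, Fin n → ℂ) x)) : Prop :=
  ∀ j, ∃ (lam : ℕ → M → ℝ) (lamBd : M → ℝ),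
    (∀ s, ContinuousOn (lam s) (closure (S.exh j))) ∧
    ContinuousOn lamBd (closure (S.exh j)) ∧
    (∀ x ∈ S.exh j, ∀ s, ∀ e : E x,
      (S.approx j s x).normSq e ≤ (S.approx j (s + 1) x).normSq e) ∧
    (∀ s, NakanoGE n r (S.approx j s) (fun x => θ x - (lam s x : ℂ) • g x) (S.exh j)) ∧
    IsNullSet n {x ∈ S.exh j | ¬ Tendsto (fun s => lam s x) atTop (𝓝 0)} ∧
    ∀ s, ∀ x ∈ S.exh j, 0 ≤ lam s x ∧ lam s x ≤ lamBd x

/-- `h` is singular Nakano semi-positive: `Θ_h(E) ≥ˢ_Nak 0`. -/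
def IsNakanoSemipositive (S : SingularHermitianMetric n r E)
    (g : ∀ x : M, SesqForm (TangentSpace 𝓘(ℂ, Fin n → ℂ) x)) : Prop :=
  S.SingularNakanoGE g (fun _ => 0)

end SingularHermitianMetric

end

open Bundle Set Filter Topology MeasureTheory
open scoped Manifold ContDiff ComplexConjugate

noncomputable section

/-! ### Circle means of functions of class `C²` -/

section CircleMeans

/-- Integrals over a compact interval depend continuously on a parameter. -/
theorem continuousOn_intervalIntegral_param {F : ℝ → ℝ → ℝ} {a b : ℝ}
    (hF : ContinuousOn (Function.uncurry F) (Icc (0 : ℝ) 1 ×ˢ univ)) :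
    ContinuousOn (fun t => ∫ θ in a..b, F t θ) (Icc 0 1) := by
  have h1 : ContinuousOn (Function.uncurry fun (t : Icc (0 : ℝ) 1) (θ : ℝ) => F t θ) univ := by
    refine hF.comp (f := fun p : Icc (0 : ℝ) 1 × ℝ => ((p.1 : ℝ), p.2)) (by fun_prop) ?_
    rintro ⟨t, θ⟩ -
    exact ⟨t.2, trivial⟩
  rw [continuousOn_univ] at h1
  rw [continuousOn_iff_continuous_domRestrict]
  exact intervalIntegral.continuous_parametric_intervalIntegral_of_continuous' h1 a b

/-- Differentiation under the integral sign. -/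
theorem hasDerivAt_intervalIntegral_param {F F' : ℝ → ℝ → ℝ} {a b : ℝ}
    (hF : ContinuousOn (Function.uncurry F) (Icc (0 : ℝ) 1 ×ˢ univ))
    (hF' : ContinuousOn (Function.uncurry F') (Icc (0 : ℝ) 1 ×ˢ univ))
    (hd : ∀ t ∈ Ioo (0 : ℝ) 1, ∀ θ, HasDerivAt (fun t => F t θ) (F' t θ) t)
    {t : ℝ} (ht : t ∈ Ioo (0 : ℝ) 1) :
    HasDerivAt (fun t => ∫ θ in a..b, F t θ) (∫ θ in a..b, F' t θ) t := by
  have hsec : ∀ {G : ℝ → ℝ → ℝ}, ContinuousOn (Function.uncurry G) (Icc (0 : ℝ) 1 ×ˢ univ) →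
      ∀ t ∈ Icc (0 : ℝ) 1, Continuous (G t) := by
    intro G hG t ht
    rw [← continuousOn_univ]
    exact hG.comp (f := fun θ => (t, θ)) (by fun_prop) fun θ _ => ⟨ht, trivial⟩
  obtain ⟨C, hC⟩ := (isCompact_Icc (a := (0 : ℝ)) (b := 1)).prod (isCompact_uIcc (a := a) (b := b))
    |>.exists_bound_of_continuousOn (hF'.mono (prod_mono subset_rfl (subset_univ _)))
  refine (intervalIntegral.hasDerivAt_integral_of_dominated_loc_of_deriv_le (𝕜 := ℝ)
    (bound := fun _ => C) (Ioo_mem_nhds ht.1 ht.2) ?_ ?_ ?_ ?_ ?_ ?_).2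
  · filter_upwards [Ioo_mem_nhds ht.1 ht.2] with s hs
    exact (hsec hF s (Ioo_subset_Icc_self hs)).aestronglyMeasurable
  · exact (hsec hF t (Ioo_subset_Icc_self ht)).intervalIntegrable _ _
  · exact (hsec hF' t (Ioo_subset_Icc_self ht)).aestronglyMeasurable
  · refine Eventually.of_forall fun θ hθ s hs => ?_
    exact hC (s, θ) ⟨Ioo_subset_Icc_self hs, uIoc_subset_uIcc hθ⟩
  · exact intervalIntegrable_const
  · exact Eventually.of_forall fun θ _ s hs => hd s hs θ

theorem circleMap_zero_mem_closedBall {t : ℝ} (ht : t ∈ Icc (0 : ℝ) 1) (θ : ℝ) :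
    circleMap 0 t θ ∈ Metric.closedBall (0 : ℂ) 1 := by
  simp [circleMap, abs_of_nonneg ht.1, ht.2]

theorem continuousOn_comp_circleMap {X : Type*} [TopologicalSpace X] {f : ℂ → X}
    (hf : ContinuousOn f (Metric.closedBall 0 1)) :
    ContinuousOn (fun p : ℝ × ℝ => f (circleMap 0 p.1 p.2)) (Icc (0 : ℝ) 1 ×ˢ univ) := by
  refine hf.comp (f := fun p : ℝ × ℝ => circleMap 0 p.1 p.2) ?_ ?_
  · unfold circleMap
    fun_prop
  · rintro ⟨t, θ⟩ ⟨ht, -⟩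
    exact circleMap_zero_mem_closedBall ht θ

/-- The real Laplacian of `φ` on `ℂ`. -/
def planeLaplacian (φ : ℂ → ℝ) (z : ℂ) : ℝ :=
  fderiv ℝ (fderiv ℝ φ) z 1 1 + fderiv ℝ (fderiv ℝ φ) z Complex.I Complex.I

theorem planeLaplacian_eq_rotated (φ : ℂ → ℝ) (z : ℂ) (θ : ℝ) :
    fderiv ℝ (fderiv ℝ φ) z (Complex.exp (θ * Complex.I)) (Complex.exp (θ * Complex.I)) +
      fderiv ℝ (fderiv ℝ φ) z (Complex.I * Complex.exp (θ * Complex.I))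
        (Complex.I * Complex.exp (θ * Complex.I)) = planeLaplacian φ z := by
  have h1 : Complex.exp (θ * Complex.I) = Real.cos θ • (1 : ℂ) + Real.sin θ • Complex.I := by
    rw [Complex.exp_mul_I]; simp
  have h2 : Complex.I * Complex.exp (θ * Complex.I) =
      (-Real.sin θ) • (1 : ℂ) + Real.cos θ • Complex.I := by
    rw [h1]; apply Complex.ext <;> simp
  rw [h2, h1]
  simp only [map_add, map_smul, add_apply, smul_apply,
    smul_eq_mul, planeLaplacian]
  linear_combination (fderiv ℝ (fderiv ℝ φ) z 1 1 + fderiv ℝ (fderiv ℝ φ) z Complex.I Complex.I) *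
    Real.sin_sq_add_cos_sq θ

theorem hasDerivAt_circleMap_radius (t θ : ℝ) :
    HasDerivAt (fun t : ℝ => circleMap 0 t θ) (Complex.exp (θ * Complex.I)) t := by
  have := (Complex.ofRealCLM.hasDerivAt (x := t)).mul_const (Complex.exp (θ * Complex.I))
  simpa [circleMap] using this

theorem hasDerivAt_exp_mul_I (θ : ℝ) :
    HasDerivAt (fun θ : ℝ => Complex.exp (θ * Complex.I))
      (Complex.I * Complex.exp (θ * Complex.I)) θ := by
  have := hasDerivAt_circleMap 0 1 θ
  simp only [circleMap_zero, Complex.ofReal_one, one_mul] at this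
  rw [mul_comm] at this
  refine this.congr_of_eventuallyEq (Eventually.of_forall fun x => ?_)
  simp [circleMap]

/-- The sub-mean value inequality on the unit circle, with an error term, for functions of class
`C²` whose Laplacian is bounded below by `-κ`. -/
theorem le_circleAverage_add_of_planeLaplacian_ge {φ κ : ℂ → ℝ} {U : Set ℂ} (hU : IsOpen U)
    (hUb : Metric.closedBall 0 1 ⊆ U) (hφ : ContDiffOn ℝ 2 φ U)
    (hκ : ContinuousOn κ (Metric.closedBall 0 1)) (hκ0 : ∀ z ∈ Metric.closedBall (0 : ℂ) 1, 0 ≤ κ z)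
    (hΔ : ∀ z ∈ Metric.closedBall (0 : ℂ) 1, -κ z ≤ planeLaplacian φ z) :
    φ 0 ≤ Real.circleAverage φ 0 1 + ∫ τ in (0 : ℝ)..1, Real.circleAverage κ 0 τ := by
  have hD1 : ContDiffOn ℝ 1 (fderiv ℝ φ) U := hφ.fderiv_of_isOpen hU (by norm_num)
  have hD2 : ContinuousOn (fderiv ℝ (fderiv ℝ φ)) U :=
    hD1.continuousOn_fderiv_of_isOpen hU le_rfl
  have hφd : ∀ z ∈ U, HasFDerivAt φ (fderiv ℝ φ z) z := fun z hz =>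
    ((hφ.differentiableOn (by norm_num)).differentiableAt (hU.mem_nhds hz)).hasFDerivAt
  have hDd : ∀ z ∈ U, HasFDerivAt (fderiv ℝ φ) (fderiv ℝ (fderiv ℝ φ) z) z := fun z hz =>
    ((hD1.differentiableOn (by norm_num)).differentiableAt (hU.mem_nhds hz)).hasFDerivAt
  have hmem : ∀ t ∈ Icc (0 : ℝ) 1, ∀ θ, circleMap 0 t θ ∈ U := fun t ht θ =>
    hUb (circleMap_zero_mem_closedBall ht θ)
  set e : ℝ → ℂ := fun θ => Complex.exp (θ * Complex.I) with he
  have hec : Continuous e := by fun_prop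
  -- the three integrands
  set F : ℝ → ℝ → ℝ := fun t θ => φ (circleMap 0 t θ) with hFdef
  set F' : ℝ → ℝ → ℝ := fun t θ => fderiv ℝ φ (circleMap 0 t θ) (e θ) with hF'def
  set G : ℝ → ℝ → ℝ := fun t θ => t * fderiv ℝ φ (circleMap 0 t θ) (e θ) with hGdef
  set G' : ℝ → ℝ → ℝ := fun t θ => fderiv ℝ φ (circleMap 0 t θ) (e θ) +
    t * fderiv ℝ (fderiv ℝ φ) (circleMap 0 t θ) (e θ) (e θ) with hG'def
  have c0 : ContinuousOn (Function.uncurry F) (Icc (0 : ℝ) 1 ×ˢ univ) :=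
    continuousOn_comp_circleMap (hφ.continuousOn.mono hUb)
  have ce : ContinuousOn (fun p : ℝ × ℝ => e p.2) (Icc (0 : ℝ) 1 ×ˢ univ) := by fun_prop
  have c1 : ContinuousOn (Function.uncurry F') (Icc (0 : ℝ) 1 ×ˢ univ) :=
    (continuousOn_comp_circleMap (hD1.continuousOn.mono hUb)).clm_apply ce
  have ct : ContinuousOn (fun p : ℝ × ℝ => p.1) (Icc (0 : ℝ) 1 ×ˢ univ) := by fun_prop
  have c2 : ContinuousOn (Function.uncurry G) (Icc (0 : ℝ) 1 ×ˢ univ) := ct.mul c1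
  have c3' := ((continuousOn_comp_circleMap (hD2.mono hUb)).clm_apply ce).clm_apply ce
  have c3 : ContinuousOn (Function.uncurry G') (Icc (0 : ℝ) 1 ×ˢ univ) := c1.add (ct.mul c3')
  have cκ : ContinuousOn (Function.uncurry fun t θ => κ (circleMap 0 t θ))
      (Icc (0 : ℝ) 1 ×ˢ univ) := continuousOn_comp_circleMap hκ
  have sec : ∀ {G : ℝ → ℝ → ℝ}, ContinuousOn (Function.uncurry G) (Icc (0 : ℝ) 1 ×ˢ univ) →
      ∀ t ∈ Icc (0 : ℝ) 1, Continuous (G t) := by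
    intro G hG t ht
    rw [← continuousOn_univ]
    exact hG.comp (f := fun θ => (t, θ)) (by fun_prop) fun θ _ => ⟨ht, trivial⟩
  have dF : ∀ t ∈ Ioo (0 : ℝ) 1, ∀ θ, HasDerivAt (fun t => F t θ) (F' t θ) t := by
    intro t ht θ
    exact (hφd _ (hmem t (Ioo_subset_Icc_self ht) θ)).comp_hasDerivAt t
      (hasDerivAt_circleMap_radius t θ)
  have dG : ∀ t ∈ Ioo (0 : ℝ) 1, ∀ θ, HasDerivAt (fun t => G t θ) (G' t θ) t := by
    intro t ht θ
    have h1 := (hDd _ (hmem t (Ioo_subset_Icc_self ht) θ)).comp_hasDerivAt t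
      (hasDerivAt_circleMap_radius t θ)
    have h2 := (hasDerivAt_id t).mul (h1.clm_apply (hasDerivAt_const t (e θ)))
    refine h2.congr_deriv ?_
    simp [hG'def, he]
  set A : ℝ → ℝ := fun t => ∫ θ in (0 : ℝ)..(2 * Real.pi), F t θ with hA
  set B : ℝ → ℝ := fun t => ∫ θ in (0 : ℝ)..(2 * Real.pi), G t θ with hB
  set k : ℝ → ℝ := fun t => ∫ θ in (0 : ℝ)..(2 * Real.pi), κ (circleMap 0 t θ) with hk
  have hpi : (0 : ℝ) ≤ 2 * Real.pi := by positivity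
  have hkc : ContinuousOn k (Icc 0 1) := continuousOn_intervalIntegral_param cκ
  have hk0 : ∀ t ∈ Icc (0 : ℝ) 1, 0 ≤ k t := fun t ht =>
    intervalIntegral.integral_nonneg hpi fun θ _ => hκ0 _ (circleMap_zero_mem_closedBall ht θ)
  -- the radial derivative of `B`
  have hBd : ∀ t ∈ Icc (0 : ℝ) 1, -(t * k t) ≤ ∫ θ in (0 : ℝ)..(2 * Real.pi), G' t θ := by
    intro t ht
    have hz : ∫ θ in (0 : ℝ)..(2 * Real.pi),
        (t * fderiv ℝ (fderiv ℝ φ) (circleMap 0 t θ) (Complex.I * e θ) (Complex.I * e θ)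
          - fderiv ℝ φ (circleMap 0 t θ) (e θ)) = 0 := by
      have hder : ∀ θ, HasDerivAt (fun θ => fderiv ℝ φ (circleMap 0 t θ) (Complex.I * e θ))
          (t * fderiv ℝ (fderiv ℝ φ) (circleMap 0 t θ) (Complex.I * e θ) (Complex.I * e θ)
          - fderiv ℝ φ (circleMap 0 t θ) (e θ)) θ := by
        intro θ
        have h1 := (hDd _ (hmem t ht θ)).comp_hasDerivAt θ (hasDerivAt_circleMap 0 t θ)
        have h2 := h1.clm_apply ((hasDerivAt_exp_mul_I θ).const_mul Complex.I)
        refine h2.congr_deriv ?_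
        have e1 : circleMap 0 t θ * Complex.I = t • (Complex.I * e θ) := by
          simp [circleMap, he]; ring
        have e2 : Complex.I * (Complex.I * Complex.exp (θ * Complex.I)) = -e θ := by
          rw [← mul_assoc, Complex.I_mul_I]; simp [he]
        rw [e1, e2, map_smul, map_neg, smul_apply, smul_eq_mul, sub_eq_add_neg]
        rfl
      rw [intervalIntegral.integral_eq_sub_of_hasDerivAt (fun θ _ => hder θ)]
      · have h2π : Complex.exp (((2 * Real.pi : ℝ) : ℂ) * Complex.I) = 1 := by
          push_cast
          exact Complex.exp_two_pi_mul_I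
        simp only [he, circleMap, h2π]
        simp
      · refine Continuous.intervalIntegrable ?_ _ _
        have hm : ContinuousOn (fun θ => circleMap 0 t θ) univ := by fun_prop
        have a1 := (hD1.continuousOn.comp hm fun θ _ => hmem t ht θ)
        have a2 := (hD2.comp hm fun θ _ => hmem t ht θ)
        rw [continuousOn_univ] at a1 a2
        have hIe : Continuous fun θ => Complex.I * e θ := by fun_prop
        exact (continuous_const.mul ((a2.clm_apply hIe).clm_apply hIe)).sub (a1.clm_apply hec)
    have hint : ∀ t ∈ Icc (0 : ℝ) 1, ∀ θ, G' t θ +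
        (t * fderiv ℝ (fderiv ℝ φ) (circleMap 0 t θ) (Complex.I * e θ) (Complex.I * e θ)
          - fderiv ℝ φ (circleMap 0 t θ) (e θ)) = t * planeLaplacian φ (circleMap 0 t θ) := by
      intro t ht θ
      rw [← planeLaplacian_eq_rotated φ _ θ]
      simp only [hG'def, he]
      ring
    have hm : ContinuousOn (fun θ => circleMap 0 t θ) univ := by fun_prop
    have a1 := (hD1.continuousOn.comp hm fun θ _ => hmem t ht θ)
    have a2 := (hD2.comp hm fun θ _ => hmem t ht θ)
    rw [continuousOn_univ] at a1 a2
    have hIe : Continuous fun θ => Complex.I * e θ := by fun_prop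
    have cz := (continuous_const (y := t)).mul ((a2.clm_apply hIe).clm_apply hIe) |>.sub
      (a1.clm_apply hec)
    have hsum := intervalIntegral.integral_add (μ := volume)
      ((sec c3 t ht).intervalIntegrable 0 (2 * Real.pi))
      (cz.intervalIntegrable 0 (2 * Real.pi))
    simp only [Function.comp_def, Pi.sub_apply, Pi.mul_apply] at hsum
    rw [hz, add_zero] at hsum
    rw [← hsum, hk, ← intervalIntegral.integral_const_mul, ← intervalIntegral.integral_neg]
    refine intervalIntegral.integral_mono_on hpi ?_ ?_ ?_
    · exact ((continuous_const.mul (sec cκ t ht)).neg).intervalIntegrable _ _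
    · exact ((sec c3 t ht).add cz).intervalIntegrable _ _
    · intro θ _
      rw [hint t ht θ]
      nlinarith [hΔ _ (circleMap_zero_mem_closedBall ht θ), ht.1]
  have hk_int : ∀ t ∈ Icc (0 : ℝ) 1, IntervalIntegrable k volume 0 t := fun t ht =>
    ContinuousOn.intervalIntegrable
      (hkc.mono (by rw [uIcc_of_le ht.1]; exact Icc_subset_Icc_right ht.2))
  have hBlow : ∀ t ∈ Icc (0 : ℝ) 1, -(t * ∫ τ in (0 : ℝ)..1, k τ) ≤ B t := by
    intro t ht
    have hsub : Icc 0 t ⊆ Icc (0 : ℝ) 1 := Icc_subset_Icc_right ht.2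
    have hcont : ContinuousOn (fun t => ∫ θ in (0 : ℝ)..(2 * Real.pi), G' t θ) (uIcc 0 t) :=
      (continuousOn_intervalIntegral_param c3).mono (by rw [uIcc_of_le ht.1]; exact hsub)
    have hftc := intervalIntegral.integral_eq_sub_of_hasDerivAt_of_le ht.1
      ((continuousOn_intervalIntegral_param c2).mono hsub)
      (fun s hs => hasDerivAt_intervalIntegral_param (a := 0) (b := 2 * Real.pi) c2 c3 dG
        ⟨hs.1, hs.2.trans_le ht.2⟩) hcont.intervalIntegrable
    have hB0 : (∫ θ in (0 : ℝ)..(2 * Real.pi), G 0 θ) = 0 := by simp [hGdef]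
    rw [hB0, sub_zero] at hftc
    change _ ≤ ∫ θ in (0 : ℝ)..(2 * Real.pi), G t θ
    rw [← hftc]
    have h1 : ∫ τ in (0 : ℝ)..t, -(t * k τ) ≤
        ∫ τ in (0 : ℝ)..t, ∫ θ in (0 : ℝ)..(2 * Real.pi), G' τ θ := by
      refine intervalIntegral.integral_mono_on ht.1 ((hk_int t ht).const_mul t).neg
        hcont.intervalIntegrable fun τ hτ => le_trans ?_ (hBd τ (hsub hτ))
      have := mul_le_mul_of_nonneg_right hτ.2 (hk0 τ (hsub hτ))
      linarith
    refine le_trans ?_ h1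
    rw [intervalIntegral.integral_neg, intervalIntegral.integral_const_mul]
    refine neg_le_neg (mul_le_mul_of_nonneg_left ?_ ht.1)
    refine intervalIntegral.integral_mono_interval le_rfl ht.1 ht.2 ?_ (hk_int 1 (by simp))
    filter_upwards [ae_restrict_mem measurableSet_Ioc] with τ hτ
    exact hk0 τ (Ioc_subset_Icc_self hτ)
  set C := ∫ τ in (0 : ℝ)..1, k τ with hC
  have hmono : MonotoneOn (fun t => A t + C * t) (Icc 0 1) := by
    refine monotoneOn_of_hasDerivWithinAt_nonneg (convex_Icc 0 1)
      ((continuousOn_intervalIntegral_param c0).add (by fun_prop))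
      (f' := fun t => (∫ θ in (0 : ℝ)..(2 * Real.pi), F' t θ) + C) ?_ ?_
    · intro t ht
      rw [interior_Icc] at ht
      have h1 := hasDerivAt_intervalIntegral_param (a := 0) (b := 2 * Real.pi) c0 c1 dF ht
      have h2 := (hasDerivAt_id t).const_mul C
      rw [mul_one] at h2
      exact (h1.add h2).hasDerivWithinAt
    · intro t ht
      rw [interior_Icc] at ht
      have h1 := hBlow t (Ioo_subset_Icc_self ht)
      have h2 : B t = t * ∫ θ in (0 : ℝ)..(2 * Real.pi), F' t θ := by
        simp only [hB, hGdef, hF'def, intervalIntegral.integral_const_mul]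
      rw [h2] at h1
      have : 0 ≤ t * ((∫ θ in (0 : ℝ)..(2 * Real.pi), F' t θ) + C) := by linarith
      exact nonneg_of_mul_nonneg_right this ht.1
  have hfin := hmono (show (0 : ℝ) ∈ Icc 0 1 by simp) (show (1 : ℝ) ∈ Icc 0 1 by simp) zero_le_one
  have hA0 : A 0 = 2 * Real.pi * φ 0 := by simp [hA, hFdef]
  have hA1 : A 1 = 2 * Real.pi * Real.circleAverage φ 0 1 := by
    rw [Real.circleAverage_def, smul_eq_mul, ← mul_assoc, mul_inv_cancel₀ (by positivity), one_mul]
  have hC1 : C = 2 * Real.pi * ∫ τ in (0 : ℝ)..1, Real.circleAverage κ 0 τ := by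
    simp only [Real.circleAverage_def, smul_eq_mul, intervalIntegral.integral_const_mul]
    rw [← mul_assoc, mul_inv_cancel₀ (by positivity), one_mul]
  simp only [hA0, hA1, hC1, mul_zero, add_zero, mul_one] at hfin
  rw [← mul_add] at hfin
  exact le_of_mul_le_mul_left hfin (by positivity)

end CircleMeans

/-! ### Wirtinger calculus for matrix-valued functions of one variable -/

section Wirtinger

/-- The operator `(∂_x + σ ∂_y) / 2` on functions of one complex variable: `∂/∂z` for `σ = -i`,
`∂/∂z̄` for `σ = i`. -/
def planeWirtinger (σ : ℂ) (f : ℂ → ℂ) (ζ : ℂ) : ℂ :=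
  (1 / 2 : ℂ) * (fderiv ℝ f ζ 1 + σ * fderiv ℝ f ζ Complex.I)

/-- `planeWirtinger`, entry by entry. -/
def planeWirtingerMat {m k : Type*} (σ : ℂ) (A : ℂ → Matrix m k ℂ) (ζ : ℂ) : Matrix m k ℂ :=
  Matrix.of fun a b => planeWirtinger σ (fun w => A w a b) ζ

theorem planeWirtinger_congr {f g : ℂ → ℂ} {ζ : ℂ} (σ : ℂ) (h : f =ᶠ[𝓝 ζ] g) :
    planeWirtinger σ f ζ = planeWirtinger σ g ζ := by
  simp only [planeWirtinger, h.fderiv_eq]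

theorem planeWirtingerMat_congr {m k : Type*} {A B : ℂ → Matrix m k ℂ} {ζ : ℂ} (σ : ℂ)
    (h : A =ᶠ[𝓝 ζ] B) : planeWirtingerMat σ A ζ = planeWirtingerMat σ B ζ := by
  ext a b
  exact planeWirtinger_congr σ (h.mono fun w hw => by simp only [hw])

theorem planeWirtinger_mul {f g : ℂ → ℂ} {ζ : ℂ} (σ : ℂ) (hf : DifferentiableAt ℝ f ζ)
    (hg : DifferentiableAt ℝ g ζ) :
    planeWirtinger σ (fun w => f w * g w) ζ =
      planeWirtinger σ f ζ * g ζ + f ζ * planeWirtinger σ g ζ := by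
  simp only [planeWirtinger, fderiv_fun_mul hf hg, add_apply, smul_apply, smul_eq_mul]
  ring

theorem planeWirtinger_sum {ι : Type*} (s : Finset ι) {f : ι → ℂ → ℂ} {ζ : ℂ} (σ : ℂ)
    (hf : ∀ i ∈ s, DifferentiableAt ℝ (f i) ζ) :
    planeWirtinger σ (fun w => ∑ i ∈ s, f i w) ζ = ∑ i ∈ s, planeWirtinger σ (f i) ζ := by
  simp only [planeWirtinger, fderiv_fun_sum hf, sum_apply, Finset.mul_sum,
    ← Finset.sum_add_distrib, mul_add]

theorem planeWirtinger_conj (f : ℂ → ℂ) (ζ : ℂ) (σ : ℂ) :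
    planeWirtinger σ (fun w => conj (f w)) ζ = conj (planeWirtinger (conj σ) f ζ) := by
  have h : fderiv ℝ (fun w => conj (f w)) ζ = Complex.conjCLE.toContinuousLinearMap ∘L
      fderiv ℝ f ζ := Complex.conjCLE.comp_fderiv
  have h2 : conj (2 : ℂ) = 2 := map_ofNat _ 2
  simp [planeWirtinger, h, h2]

theorem planeWirtinger_I_of_differentiableAt {f : ℂ → ℂ} {ζ : ℂ} (hf : DifferentiableAt ℂ f ζ) :
    planeWirtinger Complex.I f ζ = 0 := by
  have h : fderiv ℝ f ζ = (fderiv ℂ f ζ).restrictScalars ℝ :=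
    (hf.hasFDerivAt.restrictScalars ℝ).fderiv
  have h2 : fderiv ℂ f ζ Complex.I = Complex.I * fderiv ℂ f ζ 1 := by
    rw [← smul_eq_mul, ← map_smul, smul_eq_mul, mul_one]
  simp only [planeWirtinger, h, ContinuousLinearMap.coe_restrictScalars', h2]
  rw [← mul_assoc Complex.I, Complex.I_mul_I]
  ring

theorem planeWirtinger_neg_I_of_differentiableAt {f : ℂ → ℂ} {ζ : ℂ}
    (hf : DifferentiableAt ℂ f ζ) : planeWirtinger (-Complex.I) f ζ = deriv f ζ := by
  have h : fderiv ℝ f ζ = (fderiv ℂ f ζ).restrictScalars ℝ :=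
    (hf.hasFDerivAt.restrictScalars ℝ).fderiv
  have h2 : fderiv ℂ f ζ Complex.I = Complex.I * fderiv ℂ f ζ 1 := by
    rw [← smul_eq_mul, ← map_smul, smul_eq_mul, mul_one]
  simp only [planeWirtinger, h, ContinuousLinearMap.coe_restrictScalars', h2]
  rw [← mul_assoc, neg_mul, Complex.I_mul_I, fderiv_apply_one_eq_deriv]
  ring

theorem differentiableAt_planeWirtinger {f : ℂ → ℂ} {ζ : ℂ} (σ : ℂ) (hf : ContDiffAt ℝ 2 f ζ) :
    DifferentiableAt ℝ (planeWirtinger σ f) ζ := by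
  have h : DifferentiableAt ℝ (fderiv ℝ f) ζ :=
    (hf.fderiv_right (m := 1) (by norm_num)).differentiableAt (by norm_num)
  unfold planeWirtinger
  fun_prop

theorem planeLaplacian_re {f : ℂ → ℂ} {ζ : ℂ} (hf : ContDiffAt ℝ 2 f ζ) :
    planeLaplacian (fun w => (f w).re) ζ =
      4 * (planeWirtinger Complex.I (planeWirtinger (-Complex.I) f) ζ).re := by
  have hd : DifferentiableAt ℝ (fderiv ℝ f) ζ :=
    (hf.fderiv_right (m := 1) (by norm_num)).differentiableAt (by norm_num)
  have hsymm : fderiv ℝ (fderiv ℝ f) ζ 1 Complex.I = fderiv ℝ (fderiv ℝ f) ζ Complex.I 1 :=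
    (hf.isSymmSndFDerivAt (by simp)) 1 Complex.I
  have h1 : ∀ᶠ w in 𝓝 ζ, fderiv ℝ (fun w => (f w).re) w = Complex.reCLM ∘L fderiv ℝ f w := by
    filter_upwards [hf.eventually (by simp)] with w hw
    exact (Complex.reCLM.hasFDerivAt.comp w
      (hw.differentiableAt (by norm_num)).hasFDerivAt).fderiv
  have h2 : fderiv ℝ (fderiv ℝ (fun w => (f w).re)) ζ =
      (ContinuousLinearMap.compL ℝ ℂ ℂ ℝ Complex.reCLM) ∘L fderiv ℝ (fderiv ℝ f) ζ := by
    rw [Filter.EventuallyEq.fderiv_eq h1]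
    exact ((ContinuousLinearMap.compL ℝ ℂ ℂ ℝ Complex.reCLM).hasFDerivAt.comp ζ
      hd.hasFDerivAt).fderiv
  have h3 : ∀ v : ℂ, fderiv ℝ (planeWirtinger (-Complex.I) f) ζ v = (1 / 2 : ℂ) *
      (fderiv ℝ (fderiv ℝ f) ζ v 1 - Complex.I * fderiv ℝ (fderiv ℝ f) ζ v Complex.I) := by
    intro v
    have e1 := hd.hasFDerivAt.clm_apply (hasFDerivAt_const (1 : ℂ) ζ)
    have e2 := hd.hasFDerivAt.clm_apply (hasFDerivAt_const Complex.I ζ)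
    have e3 := (e1.add (e2.const_mul (-Complex.I))).const_mul (1 / 2 : ℂ)
    have e4 : fderiv ℝ (planeWirtinger (-Complex.I) f) ζ = _ := e3.fderiv
    rw [e4]
    simp [sub_eq_add_neg]
    ring
  simp only [planeLaplacian, h2, planeWirtinger, h3]
  simp [hsymm]
  ring

variable {m k l : Type*}

/-- All entries of `A` are real differentiable at `ζ`. -/
def MatrixDifferentiableAt (A : ℂ → Matrix m k ℂ) (ζ : ℂ) : Prop :=
  ∀ a b, DifferentiableAt ℝ (fun w => A w a b) ζ

theorem MatrixDifferentiableAt.mul [Fintype k] {A : ℂ → Matrix m k ℂ} {B : ℂ → Matrix k l ℂ}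
    {ζ : ℂ} (hA : MatrixDifferentiableAt A ζ) (hB : MatrixDifferentiableAt B ζ) :
    MatrixDifferentiableAt (fun w => A w * B w) ζ := by
  intro a b
  simp only [Matrix.mul_apply]
  exact DifferentiableAt.fun_sum fun i _ => (hA a i).mul (hB i b)

theorem MatrixDifferentiableAt.sub {A B : ℂ → Matrix m k ℂ}
    {ζ : ℂ} (hA : MatrixDifferentiableAt A ζ) (hB : MatrixDifferentiableAt B ζ) :
    MatrixDifferentiableAt (fun w => A w - B w) ζ := fun a b => (hA a b).sub (hB a b)

theorem MatrixDifferentiableAt.conjTranspose {A : ℂ → Matrix m k ℂ}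
    {ζ : ℂ} (hA : MatrixDifferentiableAt A ζ) :
    MatrixDifferentiableAt (fun w => (A w).conjTranspose) ζ := fun a b =>
  Complex.conjCLE.differentiableAt.comp ζ (hA b a)

theorem planeWirtingerMat_mul [Fintype k] {A : ℂ → Matrix m k ℂ} {B : ℂ → Matrix k l ℂ}
    {ζ : ℂ} (σ : ℂ) (hA : MatrixDifferentiableAt A ζ) (hB : MatrixDifferentiableAt B ζ) :
    planeWirtingerMat σ (fun w => A w * B w) ζ =
      planeWirtingerMat σ A ζ * B ζ + A ζ * planeWirtingerMat σ B ζ := by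
  ext a b
  simp only [planeWirtingerMat, Matrix.of_apply, Matrix.mul_apply, Matrix.add_apply]
  rw [planeWirtinger_sum _ σ fun i _ => (hA a i).fun_mul (hB i b), ← Finset.sum_add_distrib]
  exact Finset.sum_congr rfl fun i _ => planeWirtinger_mul σ (hA a i) (hB i b)

theorem planeWirtingerMat_sub {A B : ℂ → Matrix m k ℂ}
    {ζ : ℂ} (σ : ℂ) (hA : MatrixDifferentiableAt A ζ) (hB : MatrixDifferentiableAt B ζ) :
    planeWirtingerMat σ (fun w => A w - B w) ζ =
      planeWirtingerMat σ A ζ - planeWirtingerMat σ B ζ := by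
  ext a b
  simp only [planeWirtingerMat, Matrix.of_apply, Matrix.sub_apply, planeWirtinger,
    fderiv_fun_sub (hA a b) (hB a b), sub_apply]
  ring

theorem planeWirtingerMat_conjTranspose (A : ℂ → Matrix m k ℂ) (ζ σ : ℂ) :
    planeWirtingerMat σ (fun w => (A w).conjTranspose) ζ =
      (planeWirtingerMat (conj σ) A ζ).conjTranspose := by
  ext a b
  exact planeWirtinger_conj (fun w => A w b a) ζ σ

theorem planeWirtingerMat_const (σ ζ : ℂ) (C : Matrix m k ℂ) :
    planeWirtingerMat σ (fun _ => C) ζ = 0 := by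
  ext a b
  simp [planeWirtingerMat, planeWirtinger]

theorem planeWirtingerMat_inv [Fintype k] [DecidableEq k] {K : ℂ → Matrix k k ℂ} {ζ : ℂ} (σ : ℂ)
    (hK : MatrixDifferentiableAt K ζ) (hL : MatrixDifferentiableAt (fun w => (K w)⁻¹) ζ)
    (hu : ∀ᶠ w in 𝓝 ζ, IsUnit (K w).det) :
    planeWirtingerMat σ (fun w => (K w)⁻¹) ζ =
      -((K ζ)⁻¹ * planeWirtingerMat σ K ζ * (K ζ)⁻¹) := by
  have h1 := planeWirtingerMat_mul σ hL hK
  have h2 : planeWirtingerMat σ (fun w => (K w)⁻¹ * K w) ζ = 0 := by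
    rw [planeWirtingerMat_congr σ (B := fun _ => 1)
      (hu.mono fun w hw => Matrix.nonsing_inv_mul _ hw), planeWirtingerMat_const]
  rw [h2] at h1
  have h3 := congrArg (· * (K ζ)⁻¹) h1
  simp only [zero_mul, add_mul, Matrix.mul_assoc, Matrix.mul_nonsing_inv _ hu.self_of_nhds,
    Matrix.mul_one] at h3
  rw [Matrix.mul_assoc]
  exact eq_neg_of_add_eq_zero_left h3.symm

theorem contDiffAt_matrix_det {E : Type*} [NormedAddCommGroup E] [NormedSpace ℝ E] [Fintype k]
    [DecidableEq k] {K : E → Matrix k k ℂ} {z : E} {N : WithTop ℕ∞}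
    (hK : ∀ a b, ContDiffAt ℝ N (fun w => K w a b) z) :
    ContDiffAt ℝ N (fun w => (K w).det) z := by
  simp only [Matrix.det_apply]
  exact ContDiffAt.sum fun σ _ => ContDiffAt.const_smul _ (contDiffAt_prod fun i _ => hK _ _)

theorem contDiffAt_matrix_inv {E : Type*} [NormedAddCommGroup E] [NormedSpace ℝ E] [Fintype k]
    [DecidableEq k] {K : E → Matrix k k ℂ} {z : E} {N : WithTop ℕ∞}
    (hK : ∀ a b, ContDiffAt ℝ N (fun w => K w a b) z) (hu : IsUnit (K z).det) (a b : k) :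
    ContDiffAt ℝ N (fun w => (K w)⁻¹ a b) z := by
  simp only [Matrix.inv_def, Matrix.smul_apply, Ring.inverse_eq_inv', smul_eq_mul,
    Matrix.adjugate_apply]
  refine ((contDiffAt_matrix_det hK).inv hu.ne_zero).mul (contDiffAt_matrix_det fun i j => ?_)
  by_cases h : i = b
  · simp only [h, Matrix.updateRow_self]
    exact contDiffAt_const
  · simp only [Matrix.updateRow_ne h]
    exact hK i j

end Wirtinger

/-! ### The dual norm of a holomorphic section along a complex line -/

section DualNormLaplacian

open scoped ComplexOrder

/-- The `∂̄∂`-formula for `X K⁻¹ X*`, for `X` a holomorphic row vector and `K` a metric of class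
`C²`. -/
theorem planeWirtinger_conj_planeWirtinger_dual {k m : Type*} [Fintype k] [DecidableEq k]
    [Fintype m]
    {U : Set ℂ} (hU : IsOpen U) {K : ℂ → Matrix k k ℂ} {X : ℂ → Matrix m k ℂ}
    (hK : ∀ a b, ContDiffOn ℝ 2 (fun w => K w a b) U) (hKu : ∀ w ∈ U, IsUnit (K w).det)
    (hKh : ∀ w ∈ U, (K w).IsHermitian)
    (hX : ∀ a b, DifferentiableOn ℂ (fun w => X w a b) U) {ζ : ℂ} (hζ : ζ ∈ U) :
    planeWirtingerMat Complex.I (planeWirtingerMat (-Complex.I)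
        fun w => X w * (K w)⁻¹ * (X w).conjTranspose) ζ =
      X ζ * -planeWirtingerMat Complex.I
          (fun w => (K w)⁻¹ * planeWirtingerMat (-Complex.I) K w) ζ * (K ζ)⁻¹ * (X ζ).conjTranspose +
      (planeWirtingerMat (-Complex.I) X ζ -
          X ζ * ((K ζ)⁻¹ * planeWirtingerMat (-Complex.I) K ζ)) * (K ζ)⁻¹ *
        (planeWirtingerMat (-Complex.I) X ζ -
          X ζ * ((K ζ)⁻¹ * planeWirtingerMat (-Complex.I) K ζ)).conjTranspose := by
  have cK : ∀ w ∈ U, ∀ a b, ContDiffAt ℝ 2 (fun w => K w a b) w := fun w hw a b =>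
    (hK a b).contDiffAt (hU.mem_nhds hw)
  have dK : ∀ w ∈ U, MatrixDifferentiableAt K w := fun w hw a b =>
    (cK w hw a b).differentiableAt (by norm_num)
  have dL : ∀ w ∈ U, MatrixDifferentiableAt (fun w => (K w)⁻¹) w := fun w hw a b =>
    (contDiffAt_matrix_inv (cK w hw) (hKu w hw) a b).differentiableAt (by norm_num)
  have dX : ∀ w ∈ U, MatrixDifferentiableAt X w := fun w hw a b =>
    ((hX a b).differentiableAt (hU.mem_nhds hw)).restrictScalars ℝ
  have dK' : ∀ w ∈ U, MatrixDifferentiableAt (planeWirtingerMat (-Complex.I) K) w :=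
    fun w hw a b => differentiableAt_planeWirtinger _ (cK w hw a b)
  have hX' : ∀ a b, EqOn (fun w => planeWirtingerMat (-Complex.I) X w a b)
      (deriv fun w => X w a b) U := fun a b w hw =>
    planeWirtinger_neg_I_of_differentiableAt ((hX a b).differentiableAt (hU.mem_nhds hw))
  have hX'd : ∀ a b, DifferentiableOn ℂ (fun w => planeWirtingerMat (-Complex.I) X w a b) U :=
    fun a b => ((hX a b).deriv hU).congr (hX' a b)
  have dX' : ∀ w ∈ U, MatrixDifferentiableAt (planeWirtingerMat (-Complex.I) X) w :=
    fun w hw a b => ((hX'd a b).differentiableAt (hU.mem_nhds hw)).restrictScalars ℝ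
  have zX : ∀ w ∈ U, planeWirtingerMat Complex.I X w = 0 := fun w hw => by
    ext a b
    exact planeWirtinger_I_of_differentiableAt ((hX a b).differentiableAt (hU.mem_nhds hw))
  have zX' : ∀ w ∈ U, planeWirtingerMat Complex.I (planeWirtingerMat (-Complex.I) X) w = 0 :=
    fun w hw => by
      ext a b
      exact planeWirtinger_I_of_differentiableAt ((hX'd a b).differentiableAt (hU.mem_nhds hw))
  have iL : ∀ w ∈ U, ∀ σ, planeWirtingerMat σ (fun w => (K w)⁻¹) w =
      -((K w)⁻¹ * planeWirtingerMat σ K w * (K w)⁻¹) := fun w hw σ =>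
    planeWirtingerMat_inv σ (dK w hw) (dL w hw) (eventually_of_mem (hU.mem_nhds hw) hKu)
  set A : ℂ → Matrix k k ℂ := fun w => (K w)⁻¹ * planeWirtingerMat (-Complex.I) K w with hA
  have dA : ∀ w ∈ U, MatrixDifferentiableAt A w := fun w hw => (dL w hw).mul (dK' w hw)
  set Y : ℂ → Matrix m k ℂ := fun w => planeWirtingerMat (-Complex.I) X w - X w * A w with hY
  have dXA : ∀ w ∈ U, MatrixDifferentiableAt (fun w => X w * A w) w := fun w hw =>
    (dX w hw).mul (dA w hw)
  have dY : ∀ w ∈ U, MatrixDifferentiableAt Y w := fun w hw => (dX' w hw).sub (dXA w hw)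
  have hcI : conj (-Complex.I) = Complex.I := by simp
  -- the first derivative
  have h1 : ∀ w ∈ U, planeWirtingerMat (-Complex.I)
      (fun w => X w * (K w)⁻¹ * (X w).conjTranspose) w =
      Y w * (K w)⁻¹ * (X w).conjTranspose := by
    intro w hw
    rw [planeWirtingerMat_mul _ ((dX w hw).mul (dL w hw)) (dX w hw).conjTranspose,
      planeWirtingerMat_mul _ (dX w hw) (dL w hw), planeWirtingerMat_conjTranspose, hcI, zX w hw,
      iL w hw, Matrix.conjTranspose_zero, Matrix.mul_zero, add_zero]
    simp only [hY, hA, Matrix.sub_mul, Matrix.add_mul, Matrix.mul_neg, Matrix.neg_mul,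
      Matrix.mul_assoc]
    abel
  rw [planeWirtingerMat_congr _ (eventually_of_mem (hU.mem_nhds hζ) h1),
    planeWirtingerMat_mul _ ((dY ζ hζ).mul (dL ζ hζ)) (dX ζ hζ).conjTranspose,
    planeWirtingerMat_mul _ (dY ζ hζ) (dL ζ hζ), planeWirtingerMat_conjTranspose, iL ζ hζ,
    Complex.conj_I]
  have h2 : planeWirtingerMat Complex.I Y ζ = X ζ * -planeWirtingerMat Complex.I A ζ := by
    rw [hY, planeWirtingerMat_sub _ (dX' ζ hζ) (dXA ζ hζ), zX' ζ hζ,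
      planeWirtingerMat_mul _ (dX ζ hζ) (dA ζ hζ), zX ζ hζ]
    simp
  have h3 : planeWirtingerMat Complex.I K ζ =
      (planeWirtingerMat (-Complex.I) K ζ).conjTranspose := by
    rw [← Complex.conj_I, ← planeWirtingerMat_conjTranspose]
    exact planeWirtingerMat_congr _
      (eventually_of_mem (hU.mem_nhds hζ) fun w hw => ((hKh w hw).eq).symm)
  have h4 : ((K ζ)⁻¹).conjTranspose = (K ζ)⁻¹ := by
    rw [Matrix.conjTranspose_nonsing_inv, (hKh ζ hζ).eq]
  rw [h2, h3]
  simp only [hY, hA, Matrix.conjTranspose_sub, Matrix.conjTranspose_mul, h4, Matrix.add_mul,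
    Matrix.mul_sub, Matrix.mul_neg, Matrix.neg_mul, Matrix.mul_assoc]
  abel

/-- If the curvature of `K` is bounded below by `-c`, then the Laplacian of the squared dual norm
`ψ` of a holomorphic section is bounded below by `-4 c ψ`. -/
theorem planeLaplacian_dual_ge {r : ℕ}
    {U : Set ℂ} (hU : IsOpen U) {K : ℂ → Matrix (Fin r) (Fin r) ℂ} {ξ : ℂ → Fin r → ℂ}
    (hK : ∀ a b, ContDiffOn ℝ 2 (fun w => K w a b) U) (hKp : ∀ w ∈ U, (K w).PosDef)
    (hξ : ∀ a, DifferentiableOn ℂ (fun w => ξ w a) U) {ζ : ℂ} (hζ : ζ ∈ U) {c : ℝ}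
    (hΘ : ∀ e : Fin r → ℂ, -c * (star e ⬝ᵥ Matrix.mulVec (K ζ) e).re ≤
      (star e ⬝ᵥ Matrix.mulVec (K ζ * -planeWirtingerMat Complex.I
          (fun w => (K w)⁻¹ * planeWirtingerMat (-Complex.I) K w) ζ) e).re) :
    -(4 * c * (ξ ζ ⬝ᵥ Matrix.mulVec (K ζ)⁻¹ (star (ξ ζ))).re) ≤
      planeLaplacian (fun w => (ξ w ⬝ᵥ Matrix.mulVec (K w)⁻¹ (star (ξ w))).re) ζ := by
  have hKu : ∀ w ∈ U, IsUnit (K w).det := fun w hw =>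
    (Matrix.isUnit_iff_isUnit_det _).1 (hKp w hw).isUnit
  set X : ℂ → Matrix Unit (Fin r) ℂ := fun w => Matrix.replicateRow Unit (ξ w) with hX
  have hentry : ∀ (w : ℂ) (B : Matrix (Fin r) (Fin r) ℂ),
      (X w * B * (X w).conjTranspose) () () = ξ w ⬝ᵥ Matrix.mulVec B (star (ξ w)) := by
    intro w B
    rw [Matrix.mul_assoc]
    rfl
  set L := (K ζ)⁻¹ with hL
  have hLh : L.conjTranspose = L := by
    rw [hL, Matrix.conjTranspose_nonsing_inv, (hKp ζ hζ).isHermitian.eq]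
  have hfc : ContDiffAt ℝ 2 (fun w => ξ w ⬝ᵥ Matrix.mulVec (K w)⁻¹ (star (ξ w))) ζ := by
    have hξc : ∀ a, ContDiffAt ℝ 2 (fun w => ξ w a) ζ := fun a =>
      ((((hξ a).contDiffOn hU).contDiffAt (hU.mem_nhds hζ)).restrict_scalars ℝ)
    simp only [dotProduct, Matrix.mulVec]
    refine ContDiffAt.sum fun a _ => (hξc a).mul (ContDiffAt.sum fun b _ => ContDiffAt.mul ?_ ?_)
    · exact contDiffAt_matrix_inv (fun a b => (hK a b).contDiffAt (hU.mem_nhds hζ)) (hKu ζ hζ) a b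
    · exact Complex.conjCLE.contDiff.contDiffAt.comp ζ (hξc b)
  rw [planeLaplacian_re hfc]
  have key := planeWirtinger_conj_planeWirtinger_dual hU (X := X) hK hKu
    (fun w hw => (hKp w hw).isHermitian) (fun _ b => hξ b) hζ
  have key2 := congrFun (congrFun key ()) ()
  have hlhs : planeWirtingerMat Complex.I (planeWirtingerMat (-Complex.I)
        fun w => X w * (K w)⁻¹ * (X w).conjTranspose) ζ () () =
      planeWirtinger Complex.I (planeWirtinger (-Complex.I)
        fun w => ξ w ⬝ᵥ Matrix.mulVec (K w)⁻¹ (star (ξ w))) ζ := by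
    simp only [planeWirtingerMat, Matrix.of_apply, hentry]
  rw [hlhs] at key2
  rw [key2, Matrix.add_apply, Complex.add_re]
  set Θ := -planeWirtingerMat Complex.I (fun w => (K w)⁻¹ * planeWirtingerMat (-Complex.I) K w) ζ
  set Y := planeWirtingerMat (-Complex.I) X ζ - X ζ * ((K ζ)⁻¹ * planeWirtingerMat (-Complex.I) K ζ)
  have hY : 0 ≤ ((Y * (K ζ)⁻¹ * Y.conjTranspose) () ()).re :=
    (Complex.le_def.1 (((hKp ζ hζ).inv.posSemidef.mul_mul_conjTranspose_same Y).diag_nonneg)).1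
  have h1 : (X ζ * Θ * (K ζ)⁻¹ * (X ζ).conjTranspose) () () =
      star (Matrix.mulVec L (star (ξ ζ))) ⬝ᵥ
        Matrix.mulVec (K ζ * Θ) (Matrix.mulVec L (star (ξ ζ))) := by
    have e1 : star (Matrix.mulVec L (star (ξ ζ))) = Matrix.vecMul (ξ ζ) L := by
      rw [Matrix.star_mulVec, hLh, star_star]
    rw [e1, ← Matrix.dotProduct_mulVec, Matrix.mulVec_mulVec, Matrix.mulVec_mulVec,
      ← Matrix.mul_assoc L (K ζ) Θ, hL,
      Matrix.nonsing_inv_mul _ (hKu ζ hζ),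
      Matrix.one_mul, Matrix.mul_assoc (X ζ), hentry]
  have h2 : star (Matrix.mulVec L (star (ξ ζ))) ⬝ᵥ
        Matrix.mulVec (K ζ) (Matrix.mulVec L (star (ξ ζ))) =
      ξ ζ ⬝ᵥ Matrix.mulVec L (star (ξ ζ)) := by
    have e1 : star (Matrix.mulVec L (star (ξ ζ))) = Matrix.vecMul (ξ ζ) L := by
      rw [Matrix.star_mulVec, hLh, star_star]
    rw [e1, ← Matrix.dotProduct_mulVec, Matrix.mulVec_mulVec, Matrix.mulVec_mulVec,
      hL, Matrix.nonsing_inv_mul _ (hKu ζ hζ), Matrix.one_mul]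
  have h3 := hΘ (Matrix.mulVec L (star (ξ ζ)))
  rw [h2, ← h1] at h3
  linarith

end DualNormLaplacian

/-! ### Restriction of Wirtinger derivatives to complex lines -/

section Lines

variable {n : ℕ}

theorem fderiv_comp_line {F : (Fin n → ℂ) → ℂ} {z v : Fin n → ℂ} {ζ : ℂ}
    (hF : DifferentiableAt ℝ F (z + ζ • v)) (w : ℂ) :
    fderiv ℝ (fun ζ : ℂ => F (z + ζ • v)) ζ w = fderiv ℝ F (z + ζ • v) (w • v) := by
  have h : HasFDerivAt (fun ζ : ℂ => z + ζ • v)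
      ((ContinuousLinearMap.toSpanSingleton ℂ v).restrictScalars ℝ) ζ := by
    have := (ContinuousLinearMap.toSpanSingleton ℂ v).hasFDerivAt (x := ζ)
    exact (this.restrictScalars ℝ).const_add z
  have h2 : fderiv ℝ (fun ζ : ℂ => F (z + ζ • v)) ζ = _ := (hF.hasFDerivAt.comp ζ h).fderiv
  rw [h2]
  simp

theorem realLinear_eq_sum (D : (Fin n → ℂ) →L[ℝ] ℂ) (v : Fin n → ℂ) :
    D v = ∑ j, ((v j).re * D (Pi.single j 1) + (v j).im * D (Pi.single j Complex.I)) := by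
  have hv : v = ∑ j, ((v j).re • (Pi.single j 1 : Fin n → ℂ) +
      (v j).im • (Pi.single j Complex.I : Fin n → ℂ)) := by
    ext i
    simp only [Finset.sum_apply, Pi.add_apply, Pi.smul_apply, Pi.single_apply]
    simp [Finset.sum_add_distrib]
  conv_lhs => rw [hv]
  simp [map_sum]

theorem planeWirtinger_neg_I_comp_line {F : (Fin n → ℂ) → ℂ} {z v : Fin n → ℂ} {ζ : ℂ}
    (hF : DifferentiableAt ℝ F (z + ζ • v)) :
    planeWirtinger (-Complex.I) (fun ζ : ℂ => F (z + ζ • v)) ζ =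
      ∑ j, v j * wirtinger j F (z + ζ • v) := by
  rw [planeWirtinger, fderiv_comp_line hF, fderiv_comp_line hF, realLinear_eq_sum,
    realLinear_eq_sum _ (Complex.I • v), Finset.mul_sum, ← Finset.sum_add_distrib, Finset.mul_sum]
  refine Finset.sum_congr rfl fun j _ => ?_
  conv_rhs => rw [← Complex.re_add_im (v j)]
  simp only [wirtinger, Complex.one_re, Complex.one_im, Pi.smul_apply, smul_eq_mul, Complex.mul_re, Complex.mul_im,
    Complex.I_re, Complex.I_im]
  push_cast
  linear_combination ((1 / 2 : ℂ) * (v j).im *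
    fderiv ℝ F (z + ζ • v) (Pi.single j Complex.I)) * Complex.I_sq

theorem planeWirtinger_I_comp_line {F : (Fin n → ℂ) → ℂ} {z v : Fin n → ℂ} {ζ : ℂ}
    (hF : DifferentiableAt ℝ F (z + ζ • v)) :
    planeWirtinger Complex.I (fun ζ : ℂ => F (z + ζ • v)) ζ =
      ∑ j, conj (v j) * wirtingerBar j F (z + ζ • v) := by
  rw [planeWirtinger, fderiv_comp_line hF, fderiv_comp_line hF, realLinear_eq_sum,
    realLinear_eq_sum _ (Complex.I • v), Finset.mul_sum, ← Finset.sum_add_distrib, Finset.mul_sum]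
  refine Finset.sum_congr rfl fun j _ => ?_
  have hc : conj (v j) = (v j).re - (v j).im * Complex.I := by
    apply Complex.ext <;> simp
  simp only [hc, wirtingerBar, Complex.one_re, Complex.one_im, Pi.smul_apply, smul_eq_mul, Complex.mul_re,
    Complex.mul_im, Complex.I_re, Complex.I_im]
  push_cast
  linear_combination ((1 / 2 : ℂ) * (v j).im *
    fderiv ℝ F (z + ζ • v) (Pi.single j Complex.I)) * Complex.I_sq

/-- The curvature along a complex line in terms of the coefficients of the Chern curvature. -/
theorem planeWirtingerMat_chern_comp_line {r : ℕ} {Ω : Set (Fin n → ℂ)} (hΩ : IsOpen Ω)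
    {H : (Fin n → ℂ) → Matrix (Fin r) (Fin r) ℂ}
    (hH : ∀ a b, ContDiffOn ℝ 2 (fun w => H w a b) Ω) (hHu : ∀ w ∈ Ω, IsUnit (H w).det)
    {z v : Fin n → ℂ} {ζ : ℂ} (hζ : z + ζ • v ∈ Ω) :
    -planeWirtingerMat Complex.I (fun w : ℂ => (H (z + w • v))⁻¹ *
        planeWirtingerMat (-Complex.I) (fun w : ℂ => H (z + w • v)) w) ζ =
      ∑ j, ∑ k, (v j * conj (v k)) • chernCurvature H j k (z + ζ • v) := by
  have hc : ∀ p ∈ Ω, ∀ a b, ContDiffAt ℝ 2 (fun w => H w a b) p := fun p hp a b =>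
    (hH a b).contDiffAt (hΩ.mem_nhds hp)
  have hopen : IsOpen {w : ℂ | z + w • v ∈ Ω} := hΩ.preimage (by fun_prop)
  have h1 : ∀ w : ℂ, z + w • v ∈ Ω → planeWirtingerMat (-Complex.I) (fun w : ℂ => H (z + w • v)) w =
      ∑ j, v j • wirtingerMat j H (z + w • v) := by
    intro w hw
    ext a b
    rw [planeWirtingerMat, Matrix.of_apply,
      planeWirtinger_neg_I_comp_line (F := fun p => H p a b)
        ((hc _ hw a b).differentiableAt (by norm_num))]
    simp [Matrix.sum_apply, wirtingerMat]
  have h2 : (fun w : ℂ => (H (z + w • v))⁻¹ *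
        planeWirtingerMat (-Complex.I) (fun w : ℂ => H (z + w • v)) w) =ᶠ[𝓝 ζ]
      fun w => ∑ j, v j • ((H (z + w • v))⁻¹ * wirtingerMat j H (z + w • v)) := by
    filter_upwards [hopen.mem_nhds hζ] with w hw
    rw [h1 w hw, Finset.mul_sum]
    simp only [Matrix.mul_smul]
  rw [planeWirtingerMat_congr _ h2]
  have hw : ∀ j a b, DifferentiableAt ℝ (fun p => wirtingerMat j H p a b) (z + ζ • v) := by
    intro j a b
    have h : DifferentiableAt ℝ (fderiv ℝ fun p => H p a b) (z + ζ • v) :=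
      ((hc _ hζ a b).fderiv_right (m := 1) (by norm_num)).differentiableAt (by norm_num)
    simp only [wirtingerMat, Matrix.of_apply, wirtinger]
    fun_prop
  have hA : ∀ j a b, DifferentiableAt ℝ (fun p => ((H p)⁻¹ * wirtingerMat j H p) a b)
      (z + ζ • v) := by
    intro j a b
    simp only [Matrix.mul_apply]
    exact DifferentiableAt.fun_sum fun i _ => ((contDiffAt_matrix_inv (hc _ hζ) (hHu _ hζ) a
      i).differentiableAt (by norm_num)).mul (hw j i b)
  have hline : DifferentiableAt ℝ (fun w : ℂ => z + w • v) ζ := by fun_prop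
  ext a b
  simp only [Matrix.neg_apply, planeWirtingerMat, Matrix.of_apply, Matrix.sum_apply,
    Matrix.smul_apply, smul_eq_mul, chernCurvature, wirtingerBarMat, mul_neg,
    Finset.sum_neg_distrib]
  congr 1
  rw [planeWirtinger_sum Finset.univ Complex.I
    (f := fun j w => v j * ((H (z + w • v))⁻¹ * wirtingerMat j H (z + w • v)) a b)
    fun j _ => DifferentiableAt.const_mul ((hA j a b).comp ζ hline) _]
  refine Finset.sum_congr rfl fun j _ => ?_
  have h3 := planeWirtinger_mul (f := fun _ => v j) Complex.I (differentiableAt_const _)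
    ((hA j a b).comp ζ hline)
  have h4 : planeWirtinger Complex.I (fun _ : ℂ => v j) ζ = 0 := by simp [planeWirtinger]
  rw [h4, zero_mul, zero_add] at h3
  refine h3.trans ?_
  have h5 := planeWirtinger_I_comp_line (F := fun p => ((H p)⁻¹ * wirtingerMat j H p) a b)
    (z := z) (v := v) (hA j a b)
  refine (congrArg (v j * ·) h5).trans ?_
  rw [Finset.mul_sum]
  exact Finset.sum_congr rfl fun k _ => by ring

end Lines

/-! ### Circle averages as integrals, and averages over balls of `ℂⁿ` -/

section Averages

/-- The uniform probability measure on the angles `(0, 2π]`. -/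
def angleMeasure : Measure ℝ :=
  (ENNReal.ofReal (2 * Real.pi))⁻¹ • volume.restrict (Ioc 0 (2 * Real.pi))

instance : IsProbabilityMeasure angleMeasure := by
  constructor
  simp only [angleMeasure, Measure.smul_apply, Measure.restrict_apply MeasurableSet.univ, univ_inter,
    Real.volume_Ioc, sub_zero, smul_eq_mul]
  exact ENNReal.inv_mul_cancel (by simp [Real.pi_pos]) ENNReal.ofReal_ne_top

theorem circleAverage_eq_integral (f : ℂ → ℝ) (c : ℂ) (R : ℝ) :
    Real.circleAverage f c R = ∫ θ, f (circleMap c R θ) ∂angleMeasure := by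
  have hpi : (0 : ℝ) ≤ 2 * Real.pi := by positivity
  rw [Real.circleAverage_def, angleMeasure, integral_smul_measure,
    intervalIntegral.integral_of_le hpi, ENNReal.toReal_inv, ENNReal.toReal_ofReal hpi]

variable {n : ℕ}

theorem setIntegral_ball_unit_smul (G : (Fin n → ℂ) → ℝ) {c : ℂ} (hc : ‖c‖ = 1) (ε : ℝ) :
    ∫ w in Metric.ball (0 : Fin n → ℂ) ε, G (c • w) = ∫ w in Metric.ball (0 : Fin n → ℂ) ε, G w := by
  have hc0 : c ≠ 0 := fun h => by simp [h] at hc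
  have h1 : MeasurePreserving (fun w : Fin n → ℂ => c • w) volume volume := by
    refine volume_preserving_pi (f := fun _ (a : ℂ) => c • a) fun _ => ?_
    let cc : Circle := ⟨c, by simpa [Submonoid.unitSphere] using hc⟩
    exact (rotation cc).measurePreserving
  have h2 : MeasurableEmbedding (fun w : Fin n → ℂ => c • w) :=
    (Homeomorph.smulOfNeZero c hc0).measurableEmbedding
  have h3 := h1.setIntegral_preimage_emb h2 G (Metric.ball 0 ε)
  rw [← h3]
  congr 2
  ext w
  simp [norm_smul, hc]

variable {F : (Fin n → ℂ) → ℝ} {M : ℝ}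

theorem measurable_prod_translate {T : Type*} [MeasurableSpace T] (hF : Measurable F)
    {w : T → Fin n → ℂ} (hw : Measurable w) :
    Measurable (fun p : (Fin n → ℂ) × T => F (p.1 + w p.2)) :=
  hF.comp (measurable_fst.add (hw.comp measurable_snd))

theorem integrable_of_bounded {T : Type*} [MeasurableSpace T] {μ : Measure T} [IsFiniteMeasure μ]
    {G : T → ℝ} (hG : Measurable G) (hM : ∀ t, |G t| ≤ M) : Integrable G μ :=
  Integrable.of_bound hG.aestronglyMeasurable M (Eventually.of_forall hM)

instance (z : Fin n → ℂ) (ε : ℝ) :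
    IsFiniteMeasure ((volume : Measure (Fin n → ℂ)).restrict (Metric.ball z ε)) :=
  ⟨by simpa using measure_ball_lt_top⟩

theorem integral_ball_translate_swap {T : Type*} [MeasurableSpace T] (μ : Measure T)
    [IsProbabilityMeasure μ] (hF : Measurable F) (hM : ∀ z, |F z| ≤ M)
    {w : T → Fin n → ℂ} (hw : Measurable w) (z : Fin n → ℂ) (ε : ℝ) :
    ∫ y in Metric.ball z ε, ∫ t, F (y + w t) ∂μ =
      ∫ t, (∫ y in Metric.ball z ε, F (y + w t)) ∂μ := by
  refine integral_integral_swap (f := fun y t => F (y + w t)) ?_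
  exact integrable_of_bounded (measurable_prod_translate hF hw) fun p => hM _

theorem measurable_circleMap_smul (v : Fin n → ℂ) (ρ : ℝ) :
    Measurable fun θ : ℝ => circleMap 0 ρ θ • v :=
  ((continuous_circleMap 0 ρ).smul continuous_const).measurable

theorem volume_ball_toReal_pos (z : Fin n → ℂ) {ε : ℝ} (hε : 0 < ε) :
    0 < (volume : Measure (Fin n → ℂ)).real (Metric.ball z ε) :=
  ENNReal.toReal_pos (Metric.measure_ball_pos _ _ hε).ne' measure_ball_lt_top.ne

theorem setIntegral_ball_eq_add (G : (Fin n → ℂ) → ℝ) (z : Fin n → ℂ) (ε : ℝ) :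
    ∫ y in Metric.ball z ε, G y = ∫ w in Metric.ball 0 ε, G (z + w) := by
  have h := (measurePreserving_add_left (volume : Measure (Fin n → ℂ)) z).setIntegral_preimage_emb
    (measurableEmbedding_addLeft z) G (Metric.ball z ε)
  rw [← h]
  congr 2
  ext w
  simp [dist_eq_norm]

theorem volume_real_ball_eq (z : Fin n → ℂ) (ε : ℝ) :
    (volume : Measure (Fin n → ℂ)).real (Metric.ball z ε) =
      (volume : Measure (Fin n → ℂ)).real (Metric.ball 0 ε) := by
  simp [Measure.real, Measure.addHaar_ball_center]

/-- The sub-mean value inequality on circles, with a quadratic error, gives the one on balls. -/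
theorem mul_volume_ball_le_of_submean (hF : Measurable F) (hM : ∀ z, |F z| ≤ M) {B ε : ℝ}
    (hB : 0 ≤ B) {z : Fin n → ℂ}
    (h : ∀ w : Fin n → ℂ, ‖w‖ < ε →
      F z ≤ Real.circleAverage (fun ζ : ℂ => F (z + ζ • w)) 0 1 + ‖w‖ ^ 2 * B) :
    (F z - ε ^ 2 * B) * (volume : Measure (Fin n → ℂ)).real (Metric.ball z ε) ≤
      ∫ y in Metric.ball z ε, F y := by
  have hm : Measurable fun p : (Fin n → ℂ) × ℝ => F (z + circleMap 0 1 p.2 • p.1) := by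
    refine hF.comp (Continuous.measurable ?_)
    have := continuous_circleMap 0 1
    fun_prop
  have hint : Integrable (fun p : (Fin n → ℂ) × ℝ => F (z + circleMap 0 1 p.2 • p.1))
      ((volume.restrict (Metric.ball 0 ε)).prod angleMeasure) :=
    integrable_of_bounded hm fun p => hM _
  have h1 : ∫ w in Metric.ball (0 : Fin n → ℂ) ε, ∫ θ, F (z + circleMap 0 1 θ • w) ∂angleMeasure =
      ∫ y in Metric.ball z ε, F y := by
    rw [integral_integral_swap (f := fun w θ => F (z + circleMap 0 1 θ • w)) hint]
    have h2 : ∀ θ : ℝ, ∫ w in Metric.ball (0 : Fin n → ℂ) ε, F (z + circleMap 0 1 θ • w) =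
        ∫ y in Metric.ball z ε, F y := by
      intro θ
      rw [setIntegral_ball_unit_smul (fun w => F (z + w)) (by simp), ← setIntegral_ball_eq_add]
    simp [h2]
  rw [← h1, volume_real_ball_eq, mul_comm, ← smul_eq_mul, ← setIntegral_const]
  refine setIntegral_mono_on (integrableOn_const measure_ball_lt_top.ne) hint.integral_prod_left
    measurableSet_ball fun w hw => ?_
  rw [mem_ball_zero_iff] at hw
  have h3 := h w hw
  rw [circleAverage_eq_integral] at h3
  have h4 : ‖w‖ ^ 2 * B ≤ ε ^ 2 * B := by gcongr
  linarith

/-- A bounded upper semicontinuous function satisfying the sub-mean value inequality with a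
quadratic error is the limit of its averages over small balls. -/
theorem tendsto_average_ball_of_submean (hF : Measurable F) (hM : ∀ z, |F z| ≤ M) {B R : ℝ}
    (hB : 0 ≤ B) (hR : 0 < R) {z : Fin n → ℂ}
    (h : ∀ w : Fin n → ℂ, ‖w‖ < R →
      F z ≤ Real.circleAverage (fun ζ : ℂ => F (z + ζ • w)) 0 1 + ‖w‖ ^ 2 * B)
    (husc : UpperSemicontinuousAt F z) :
    Tendsto (fun ε => (∫ y in Metric.ball z ε, F y) /
      (volume : Measure (Fin n → ℂ)).real (Metric.ball z ε)) (𝓝[>] 0) (𝓝 (F z)) := by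
  have hlow : ∀ᶠ ε in 𝓝[>] (0 : ℝ), F z - ε ^ 2 * B ≤ (∫ y in Metric.ball z ε, F y) /
      (volume : Measure (Fin n → ℂ)).real (Metric.ball z ε) := by
    filter_upwards [Ioo_mem_nhdsGT hR] with ε hε
    rw [le_div_iff₀ (volume_ball_toReal_pos z hε.1)]
    exact mul_volume_ball_le_of_submean hF hM hB fun w hw => h w (hw.trans hε.2)
  have hlim : Tendsto (fun ε : ℝ => F z - ε ^ 2 * B) (𝓝[>] 0) (𝓝 (F z)) := by
    have : Tendsto (fun ε : ℝ => F z - ε ^ 2 * B) (𝓝 0) (𝓝 (F z - 0 ^ 2 * B)) :=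
      Continuous.tendsto (by fun_prop) 0
    simp only [ne_eq, OfNat.ofNat_ne_zero, not_false_eq_true, zero_pow, zero_mul, sub_zero] at this
    exact this.mono_left nhdsWithin_le_nhds
  refine tendsto_order.2 ⟨fun a ha => ?_, fun a ha => ?_⟩
  · filter_upwards [hlow, (tendsto_order.1 hlim).1 a ha] with ε h1 h2
    exact h2.trans_le h1
  · obtain ⟨b, hb1, hb2⟩ := exists_between ha
    obtain ⟨δ, hδ, hδb⟩ := Metric.eventually_nhds_iff_ball.1 (husc b hb1)
    filter_upwards [Ioo_mem_nhdsGT hδ] with ε hε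
    refine lt_of_le_of_lt ?_ hb2
    rw [div_le_iff₀ (volume_ball_toReal_pos z hε.1), mul_comm, ← smul_eq_mul, ← setIntegral_const]
    exact setIntegral_mono_on (integrable_of_bounded hF hM)
      (integrableOn_const measure_ball_lt_top.ne) measurableSet_ball
      fun y hy => (hδb y (Metric.ball_subset_ball hε.2.le hy)).le

end Averages

/-! ### Decreasing limits of almost plurisubharmonic functions -/

section Limits

variable {n : ℕ}

theorem setIntegral_ball_translate (G : (Fin n → ℂ) → ℝ) (z u : Fin n → ℂ) (ε : ℝ) :
    ∫ y in Metric.ball z ε, G (y + u) = ∫ y in Metric.ball (z + u) ε, G y := by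
  rw [setIntegral_ball_eq_add, setIntegral_ball_eq_add G (z + u)]
  simp only [add_right_comm]

theorem tendsto_integral_ball_translate {T : Type*} [MeasurableSpace T] (μ : Measure T)
    [IsProbabilityMeasure μ] {Φ : ℕ → (Fin n → ℂ) → ℝ} {F : (Fin n → ℂ) → ℝ} {M : ℝ}
    (hΦ : ∀ s, Measurable (Φ s)) (hF : Measurable F) (hΦM : ∀ s z, |Φ s z| ≤ M)
    (hFM : ∀ z, |F z| ≤ M) (hlim : ∀ᵐ z, Tendsto (fun s => Φ s z) atTop (𝓝 (F z)))
    {w : T → Fin n → ℂ} (hw : Measurable w) (z : Fin n → ℂ) (ε : ℝ) :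
    Tendsto (fun s => ∫ y in Metric.ball z ε, ∫ t, Φ s (y + w t) ∂μ) atTop
      (𝓝 (∫ y in Metric.ball z ε, ∫ t, F (y + w t) ∂μ)) := by
  simp only [integral_ball_translate_swap μ (hΦ _) (hΦM _) hw,
    integral_ball_translate_swap μ hF hFM hw]
  refine tendsto_integral_of_dominated_convergence
    (fun _ => M * (volume : Measure (Fin n → ℂ)).real (Metric.ball z ε)) ?_
    (integrable_const _) ?_ ?_
  · intro s
    have h := (measurable_prod_translate (hΦ s) hw).stronglyMeasurable
    exact (h.integral_prod_left' (μ := volume.restrict (Metric.ball z ε))).aestronglyMeasurable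
  · refine fun s => Eventually.of_forall fun t => ?_
    exact norm_setIntegral_le_of_norm_le_const measure_ball_lt_top fun y _ => hΦM s _
  · refine Eventually.of_forall fun t => ?_
    refine tendsto_integral_of_dominated_convergence (fun _ => M) ?_ (integrable_const _) ?_ ?_
    · exact fun s => ((hΦ s).comp (measurable_add_const (w t))).aestronglyMeasurable
    · exact fun s => Eventually.of_forall fun y => hΦM s _
    · exact ae_restrict_of_ae
        ((measurePreserving_add_right volume (w t)).quasiMeasurePreserving.ae hlim)

/-- Let `F` be the limit of bounded functions `Ψ s` which satisfy the sub-mean value inequality on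
circles up to errors `β s`, where the `β s` are bounded and tend to `0` almost everywhere.  If `F`
is upper semicontinuous, it is the limit of its averages over balls, and satisfies the sub-mean
value inequality. -/
theorem submean_of_tendsto {Ψ β : ℕ → (Fin n → ℂ) → ℝ} {F : (Fin n → ℂ) → ℝ} {M B R : ℝ}
    (hΨ : ∀ s, Measurable (Ψ s)) (hβ : ∀ s, Measurable (β s)) (hΨM : ∀ s z, |Ψ s z| ≤ M)
    (hβB : ∀ s z, |β s z| ≤ B) (hF : ∀ z, Tendsto (fun s => Ψ s z) atTop (𝓝 (F z)))
    (hβ0 : ∀ᵐ z, Tendsto (fun s => β s z) atTop (𝓝 0)) {z : Fin n → ℂ}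
    (hsm : ∀ s y w, dist y z + ‖w‖ < R →
      Ψ s y ≤ Real.circleAverage (fun ζ : ℂ => Ψ s (y + ζ • w)) 0 1 +
        ‖w‖ ^ 2 * ∫ τ in (0 : ℝ)..1, Real.circleAverage (fun ζ : ℂ => β s (y + ζ • w)) 0 τ)
    (husc : ∀ y ∈ Metric.ball z R, UpperSemicontinuousAt F y) :
    (∀ y ∈ Metric.ball z R, Tendsto (fun ε => (∫ y in Metric.ball y ε, F y) /
      (volume : Measure (Fin n → ℂ)).real (Metric.ball y ε)) (𝓝[>] 0) (𝓝 (F y))) ∧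
    ∀ w : Fin n → ℂ, ‖w‖ < R → F z ≤ Real.circleAverage (fun ζ : ℂ => F (z + ζ • w)) 0 1 := by
  have hFm : Measurable F := measurable_of_tendsto_metrizable hΨ (tendsto_pi_nhds.2 hF)
  have hFM : ∀ z, |F z| ≤ M := fun z =>
    le_of_tendsto (hF z).abs (Eventually.of_forall fun s => hΨM s z)
  have hB : 0 ≤ B := (abs_nonneg _).trans (hβB 0 0)
  have hw1 : ∀ w : Fin n → ℂ, Measurable fun θ : ℝ => circleMap 0 1 θ • w :=
    fun w => measurable_circleMap_smul w 1
  -- the limit satisfies the sub-mean value inequality with a quadratic error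
  have hFsm : ∀ y w : Fin n → ℂ, dist y z + ‖w‖ < R →
      F y ≤ Real.circleAverage (fun ζ : ℂ => F (y + ζ • w)) 0 1 + ‖w‖ ^ 2 * B := by
    intro y w hyw
    have h1 : Tendsto (fun s => Real.circleAverage (fun ζ : ℂ => Ψ s (y + ζ • w)) 0 1) atTop
        (𝓝 (Real.circleAverage (fun ζ : ℂ => F (y + ζ • w)) 0 1)) := by
      simp only [circleAverage_eq_integral]
      refine tendsto_integral_of_dominated_convergence (fun _ => M) ?_ (integrable_const _) ?_ ?_
      · exact fun s => ((hΨ s).comp ((hw1 w).const_add y)).aestronglyMeasurable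
      · exact fun s => Eventually.of_forall fun y => hΨM s _
      · exact Eventually.of_forall fun θ => hF _
    refine le_of_tendsto_of_tendsto' (hF y) (h1.add_const (‖w‖ ^ 2 * B)) fun s => ?_
    refine (hsm s y w hyw).trans ?_
    gcongr
    refine (le_abs_self _).trans ?_
    have h2 := intervalIntegral.norm_integral_le_of_norm_le_const (a := 0) (b := 1) (C := B)
      (f := fun τ => Real.circleAverage (fun ζ : ℂ => β s (y + ζ • w)) 0 τ) fun τ _ => by
        rw [circleAverage_eq_integral]
        simpa using norm_integral_le_of_norm_le_const (μ := angleMeasure)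
          (f := fun θ => β s (y + circleMap 0 τ θ • w)) (C := B)
          (Eventually.of_forall fun θ => hβB s _)
    simpa using h2
  have havg : ∀ y ∈ Metric.ball z R, Tendsto (fun ε => (∫ y in Metric.ball y ε, F y) /
      (volume : Measure (Fin n → ℂ)).real (Metric.ball y ε)) (𝓝[>] 0) (𝓝 (F y)) := by
    intro y hy
    rw [Metric.mem_ball] at hy
    exact tendsto_average_ball_of_submean hFm hFM hB (sub_pos.2 hy)
      (fun w hw => hFsm y w (by linarith)) (husc y hy)
  refine ⟨havg, fun w hw => ?_⟩
  have hR : 0 < R := (norm_nonneg w).trans_lt hw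
  -- integrate the inequality for `Ψ s` over a small ball and let `s` tend to infinity
  have hball : ∀ ε ∈ Ioo 0 (R - ‖w‖), ∫ y in Metric.ball z ε, F y ≤
      ∫ θ, (∫ y in Metric.ball z ε, F (y + circleMap 0 1 θ • w)) ∂angleMeasure := by
    intro ε hε
    rw [← integral_ball_translate_swap angleMeasure hFm hFM (hw1 w)]
    have t1 : Tendsto (fun s => ∫ y in Metric.ball z ε, Ψ s y) atTop
        (𝓝 (∫ y in Metric.ball z ε, F y)) := by
      refine tendsto_integral_of_dominated_convergence (fun _ => M) ?_ (integrable_const _) ?_ ?_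
      · exact fun s => (hΨ s).aestronglyMeasurable
      · exact fun s => Eventually.of_forall fun y => hΨM s _
      · exact Eventually.of_forall hF
    have t2 := tendsto_integral_ball_translate angleMeasure hΨ hFm hΨM hFM (Eventually.of_forall hF)
      (hw1 w) z ε
    have : IsProbabilityMeasure ((volume : Measure ℝ).restrict (Ioc 0 1)) := ⟨by simp⟩
    have hw2 : Measurable fun t : ℝ × ℝ => circleMap 0 t.1 t.2 • w := by
      refine Continuous.measurable ?_
      unfold circleMap
      fun_prop
    have t3 := tendsto_integral_ball_translate ((volume.restrict (Ioc 0 1)).prod angleMeasure)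
      hβ measurable_const hβB (F := fun _ => 0) (fun _ => by simpa using hB) hβ0 hw2 z ε
    simp only [integral_zero] at t3
    have t4 := t2.add (t3.const_mul (‖w‖ ^ 2))
    rw [mul_zero, add_zero] at t4
    refine le_of_tendsto_of_tendsto' t1 t4 fun s => ?_
    have i2 : Integrable (fun p : (Fin n → ℂ) × ℝ => Ψ s (p.1 + circleMap 0 1 p.2 • w))
        ((volume.restrict (Metric.ball z ε)).prod angleMeasure) :=
      integrable_of_bounded (measurable_prod_translate (hΨ s) (hw1 w)) fun _ => hΨM s _
    have i3 : Integrable (fun p : (Fin n → ℂ) × ℝ × ℝ => β s (p.1 + circleMap 0 p.2.1 p.2.2 • w))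
        ((volume.restrict (Metric.ball z ε)).prod
          ((volume.restrict (Ioc 0 1)).prod angleMeasure)) :=
      integrable_of_bounded (measurable_prod_translate (hβ s) hw2) fun _ => hβB s _
    rw [← integral_const_mul, ← integral_add i2.integral_prod_left
      (i3.integral_prod_left.const_mul _)]
    refine setIntegral_mono_on (integrable_of_bounded (hΨ s) (hΨM s))
      (i2.integral_prod_left.add (i3.integral_prod_left.const_mul _)) measurableSet_ball
      fun y hy => ?_
    rw [Metric.mem_ball] at hy
    refine (hsm s y w (by linarith [hε.2])).trans_eq ?_
    congr 1
    · rw [circleAverage_eq_integral]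
    · rw [intervalIntegral.integral_of_le zero_le_one, integral_prod]
      · simp only [circleAverage_eq_integral]
      · exact integrable_of_bounded ((hβ s).comp (hw2.const_add y)) fun _ => hβB s _
  -- let the radius of the ball tend to zero
  have hmem : ∀ θ : ℝ, z + circleMap 0 1 θ • w ∈ Metric.ball z R := by
    intro θ
    simpa [dist_eq_norm, norm_smul] using hw
  have t5 : Tendsto (fun ε => ∫ θ, ((∫ y in Metric.ball z ε, F (y + circleMap 0 1 θ • w)) /
      (volume : Measure (Fin n → ℂ)).real (Metric.ball z ε)) ∂angleMeasure) (𝓝[>] 0)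
      (𝓝 (∫ θ, F (z + circleMap 0 1 θ • w) ∂angleMeasure)) := by
    refine tendsto_integral_filter_of_dominated_convergence (fun _ => M) ?_ ?_
      (integrable_const _) ?_
    · refine Eventually.of_forall fun ε => ?_
      have h := (measurable_prod_translate hFm (hw1 w)).stronglyMeasurable
      exact ((h.integral_prod_left' (μ := volume.restrict (Metric.ball z ε))).measurable.div_const
        _).aestronglyMeasurable
    · filter_upwards [self_mem_nhdsWithin] with ε hε
      refine Eventually.of_forall fun θ => ?_
      rw [norm_div, Real.norm_of_nonneg (volume_ball_toReal_pos z hε).le,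
        div_le_iff₀ (volume_ball_toReal_pos z hε)]
      exact norm_setIntegral_le_of_norm_le_const measure_ball_lt_top fun y _ => hFM _
    · refine Eventually.of_forall fun θ => ?_
      have h := havg _ (hmem θ)
      simp only [← setIntegral_ball_translate, volume_real_ball_eq (z + circleMap 0 1 θ • w),
        ← volume_real_ball_eq z] at h
      exact h
  rw [circleAverage_eq_integral]
  refine le_of_tendsto_of_tendsto (havg z (Metric.mem_ball_self hR)) t5 ?_
  filter_upwards [Ioo_mem_nhdsGT (sub_pos.2 hw)] with ε hε
  rw [integral_div]
  exact div_le_div_of_nonneg_right (hball ε hε) measureReal_nonneg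

end Limits

section LocalForm

variable {n : ℕ}

theorem measurable_indicator_of_continuousOn {f : (Fin n → ℂ) → ℝ} {K : Set (Fin n → ℂ)}
    (hK : MeasurableSet K) (hf : ContinuousOn f K) : Measurable (K.indicator f) := by
  classical
  rw [← Set.piecewise_eq_indicator]
  exact ContinuousOn.measurable_piecewise hf continuousOn_const hK

/-- The limit of a decreasing sequence of functions satisfying the sub-mean value inequality up to
locally bounded errors which tend to `0` almost everywhere satisfies the sub-mean value
inequality, and is the limit of its averages over balls. -/
theorem submean_of_antitone_limit {Ω : Set (Fin n → ℂ)} (hΩ : IsOpen Ω)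
    {ψ b : ℕ → (Fin n → ℂ) → ℝ} {f B : (Fin n → ℂ) → ℝ}
    (hψc : ∀ s, ContinuousOn (ψ s) Ω) (hψ0 : ∀ s, ∀ z ∈ Ω, 0 ≤ ψ s z)
    (hanti : ∀ z ∈ Ω, Antitone fun s => ψ s z)
    (hbc : ∀ s, ContinuousOn (b s) Ω) (hb0 : ∀ s, ∀ z ∈ Ω, 0 ≤ b s z)
    (hBc : ContinuousOn B Ω) (hbB : ∀ s, ∀ z ∈ Ω, b s z ≤ B z)
    (hblim : ∀ᵐ z, z ∈ Ω → Tendsto (fun s => b s z) atTop (𝓝 0))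
    (hsm : ∀ s y w, (∀ ζ ∈ Metric.closedBall (0 : ℂ) 1, y + ζ • w ∈ Ω) →
      ψ s y ≤ Real.circleAverage (fun ζ : ℂ => ψ s (y + ζ • w)) 0 1 +
        ‖w‖ ^ 2 * ∫ τ in (0 : ℝ)..1, Real.circleAverage (fun ζ : ℂ => b s (y + ζ • w)) 0 τ)
    (hf : ∀ z ∈ Ω, Tendsto (fun s => ψ s z) atTop (𝓝 (f z))) {z : Fin n → ℂ} (hz : z ∈ Ω) :
    Tendsto (fun ε => (∫ y in Metric.ball z ε, f y) /
      (volume : Measure (Fin n → ℂ)).real (Metric.ball z ε)) (𝓝[>] 0) (𝓝 (f z)) ∧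
    ∀ v : Fin n → ℂ, ∀ᶠ ρ : ℝ in 𝓝[>] 0,
      CircleIntegrable (fun ζ : ℂ => f (z + ζ • v)) 0 ρ ∧
      f z ≤ Real.circleAverage (fun ζ : ℂ => f (z + ζ • v)) 0 ρ := by
  obtain ⟨R, hR, hRΩ⟩ := Metric.nhds_basis_closedBall.mem_iff.1 (hΩ.mem_nhds hz)
  set K := Metric.closedBall z R with hK
  have hKc : IsCompact K := isCompact_closedBall z R
  have hKm : MeasurableSet K := hKc.measurableSet
  obtain ⟨M, hM⟩ := hKc.exists_bound_of_continuousOn ((hψc 0).mono hRΩ)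
  obtain ⟨B₀, hB₀⟩ := hKc.exists_bound_of_continuousOn (hBc.mono hRΩ)
  have hzK : z ∈ K := Metric.mem_closedBall_self hR.le
  have hM0 : 0 ≤ M := (norm_nonneg _).trans (hM z hzK)
  have hB0 : 0 ≤ B₀ := (norm_nonneg _).trans (hB₀ z hzK)
  have hball : ∀ y ∈ Metric.ball z R, K ∈ 𝓝 y := fun y hy =>
    mem_of_superset (Metric.isOpen_ball.mem_nhds hy) Metric.ball_subset_closedBall
  have hdisc : ∀ y w : Fin n → ℂ, dist y z + ‖w‖ < R → ∀ ζ ∈ Metric.closedBall (0 : ℂ) 1,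
      y + ζ • w ∈ K := by
    intro y w hyw ζ hζ
    rw [mem_closedBall_zero_iff] at hζ
    rw [hK, Metric.mem_closedBall, dist_eq_norm, add_sub_right_comm]
    refine (norm_add_le _ _).trans ?_
    rw [norm_smul, ← dist_eq_norm]
    nlinarith [norm_nonneg w]
  have hψM : ∀ s, ∀ y ∈ K, |ψ s y| ≤ M := by
    intro s y hy
    rw [abs_of_nonneg (hψ0 s y (hRΩ hy))]
    exact (hanti y (hRΩ hy) (Nat.zero_le s)).trans ((le_abs_self _).trans (hM y hy))
  have hbM : ∀ s, ∀ y ∈ K, |b s y| ≤ B₀ := by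
    intro s y hy
    rw [abs_of_nonneg (hb0 s y (hRΩ hy))]
    exact (hbB s y (hRΩ hy)).trans ((le_abs_self _).trans (hB₀ y hy))
  set Ψ : ℕ → (Fin n → ℂ) → ℝ := fun s => K.indicator (ψ s) with hΨ
  set β : ℕ → (Fin n → ℂ) → ℝ := fun s => K.indicator (b s) with hβ
  set F : (Fin n → ℂ) → ℝ := K.indicator f with hF
  have hΨm : ∀ s, Measurable (Ψ s) := fun s =>
    measurable_indicator_of_continuousOn hKm ((hψc s).mono hRΩ)
  have hΨM : ∀ s y, |Ψ s y| ≤ M := by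
    intro s y
    by_cases hy : y ∈ K
    · simpa [hΨ, hy] using hψM s y hy
    · simpa [hΨ, hy] using hM0
  have hFlim : ∀ y, Tendsto (fun s => Ψ s y) atTop (𝓝 (F y)) := by
    intro y
    by_cases hy : y ∈ K
    · simpa [hΨ, hF, hy] using hf y (hRΩ hy)
    · simp [hΨ, hF, hy]
  have key := submean_of_tendsto (z := z) (R := R) (B := B₀) hΨm
    (fun s => measurable_indicator_of_continuousOn hKm ((hbc s).mono hRΩ)) hΨM (β := β)
    (by
      intro s y
      by_cases hy : y ∈ K
      · simpa [hβ, hy] using hbM s y hy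
      · simpa [hβ, hy] using hB0) hFlim
    (by
      filter_upwards [hblim] with y hy
      by_cases hyK : y ∈ K
      · simpa [hβ, hyK] using hy (hRΩ hyK)
      · simp [hβ, hyK])
    (by
      intro s y w hyw
      have hd := hdisc y w hyw
      have hy : y ∈ K := by simpa using hd 0 (by simp)
      have h := hsm s y w fun ζ hζ => hRΩ (hd ζ hζ)
      have e1 : Real.circleAverage (fun ζ : ℂ => Ψ s (y + ζ • w)) 0 1 =
          Real.circleAverage (fun ζ : ℂ => ψ s (y + ζ • w)) 0 1 := by
        refine Real.circleAverage_congr_sphere fun ζ hζ => ?_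
        exact indicator_of_mem (hd ζ (Metric.sphere_subset_closedBall (by simpa using hζ))) _
      have e2 : ∫ τ in (0 : ℝ)..1, Real.circleAverage (fun ζ : ℂ => β s (y + ζ • w)) 0 τ =
          ∫ τ in (0 : ℝ)..1, Real.circleAverage (fun ζ : ℂ => b s (y + ζ • w)) 0 τ := by
        refine intervalIntegral.integral_congr fun τ hτ => ?_
        rw [uIcc_of_le zero_le_one] at hτ
        refine Real.circleAverage_congr_sphere fun ζ hζ => ?_
        refine indicator_of_mem (hd ζ ?_) _
        rw [mem_sphere_zero_iff_norm, abs_of_nonneg hτ.1] at hζ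
        rw [mem_closedBall_zero_iff, hζ]
        exact hτ.2
      rw [e1, e2]
      simpa [hΨ, hy] using h)
    (by
      intro y hy a ha
      have hyK : y ∈ K := Metric.ball_subset_closedBall hy
      obtain ⟨s, hs⟩ := ((hFlim y).eventually (gt_mem_nhds ha)).exists
      rw [hΨ] at hs
      simp only [indicator_of_mem hyK] at hs
      filter_upwards [hball y hy, ((hψc s).continuousAt (hΩ.mem_nhds (hRΩ hyK))).eventually
        (gt_mem_nhds hs)] with x hx hxs
      rw [hF, indicator_of_mem hx]
      exact ((hanti x (hRΩ hx)).le_of_tendsto (hf x (hRΩ hx)) s).trans_lt hxs)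
  have hFM : ∀ y, |F y| ≤ M := fun y =>
    le_of_tendsto (hFlim y).abs (Eventually.of_forall fun s => hΨM s y)
  have hFm : Measurable F := measurable_of_tendsto_metrizable hΨm (tendsto_pi_nhds.2 hFlim)
  have hFz : F z = f z := indicator_of_mem hzK f
  constructor
  · have h := key.1 z (Metric.mem_ball_self hR)
    rw [hFz] at h
    refine h.congr' ?_
    filter_upwards [Ioo_mem_nhdsGT hR] with ε hε
    congr 1
    exact setIntegral_congr_fun measurableSet_ball fun y hy =>
      indicator_of_mem (Metric.ball_subset_closedBall (Metric.ball_subset_ball hε.2.le hy)) f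
  · intro v
    have hlt : ∀ᶠ ρ : ℝ in 𝓝[>] 0, ρ * ‖v‖ < R := by
      have h : Tendsto (fun ρ : ℝ => ρ * ‖v‖) (𝓝 0) (𝓝 (0 * ‖v‖)) :=
        Continuous.tendsto (by fun_prop) 0
      rw [zero_mul] at h
      exact nhdsWithin_le_nhds (h.eventually (gt_mem_nhds hR))
    filter_upwards [hlt, self_mem_nhdsWithin] with ρ hρ hρ0
    have hρ0' : 0 < ρ := hρ0
    have hw : ‖(ρ : ℂ) • v‖ < R := by
      rw [norm_smul, Complex.norm_real, Real.norm_of_nonneg hρ0'.le]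
      exact hρ
    have hcm : ∀ θ : ℝ, circleMap 0 ρ θ • v = circleMap 0 1 θ • (ρ : ℂ) • v := by
      intro θ
      rw [smul_smul]
      congr 1
      simp [circleMap, mul_comm]
    have hfF : ∀ θ : ℝ, f (z + circleMap 0 ρ θ • v) = F (z + circleMap 0 1 θ • (ρ : ℂ) • v) := by
      intro θ
      rw [hcm]
      refine (indicator_of_mem (hdisc z _ (by simpa using hw) _ ?_) f).symm
      exact circleMap_zero_mem_closedBall (by simp) θ
    constructor
    · rw [circleIntegrable_def]
      simp only [hfF]
      rw [intervalIntegrable_iff, uIoc_of_le (by positivity)]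
      exact integrable_of_bounded (hFm.comp ((measurable_circleMap_smul _ 1).const_add z))
        fun _ => hFM _
    · have h := key.2 _ hw
      rw [hFz, circleAverage_eq_integral] at h
      rw [circleAverage_eq_integral]
      simp only [hfF]
      exact h

end LocalForm

section DualNormSubmean

open scoped ComplexOrder

variable {n r : ℕ}

theorem contDiffOn_dualNorm {E : Type*} [NormedAddCommGroup E] [NormedSpace ℝ E] {Ω : Set E}
    (hΩ : IsOpen Ω) {H : E → Matrix (Fin r) (Fin r) ℂ} {ξ : E → Fin r → ℂ}
    (hH : ∀ a b, ContDiffOn ℝ 2 (fun w => H w a b) Ω) (hHp : ∀ w ∈ Ω, (H w).PosDef)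
    (hξ : ∀ a, ContDiffOn ℝ 2 (fun w => ξ w a) Ω) :
    ContDiffOn ℝ 2 (fun w => (ξ w ⬝ᵥ Matrix.mulVec (H w)⁻¹ (star (ξ w))).re) Ω := by
  intro z hz
  refine ContDiffAt.contDiffWithinAt ?_
  have hξc : ∀ a, ContDiffAt ℝ 2 (fun w => ξ w a) z := fun a =>
    (hξ a).contDiffAt (hΩ.mem_nhds hz)
  refine Complex.reCLM.contDiff.contDiffAt.comp z ?_
  simp only [dotProduct, Matrix.mulVec]
  refine ContDiffAt.sum fun a _ => (hξc a).mul (ContDiffAt.sum fun b _ => ContDiffAt.mul ?_ ?_)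
  · exact contDiffAt_matrix_inv (fun a b => (hH a b).contDiffAt (hΩ.mem_nhds hz))
      ((Matrix.isUnit_iff_isUnit_det _).1 (hHp z hz).isUnit) a b
  · exact Complex.conjCLE.contDiff.contDiffAt.comp z (hξc b)

theorem circleAverage_const_mul (a : ℝ) (g : ℂ → ℝ) (c : ℂ) (R : ℝ) :
    Real.circleAverage (fun ζ => a * g ζ) c R = a * Real.circleAverage g c R := by
  simp only [circleAverage_eq_integral, integral_const_mul]

theorem dualNorm_nonneg {H : Matrix (Fin r) (Fin r) ℂ} (hH : H.PosDef) (ξ : Fin r → ℂ) :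
    0 ≤ (ξ ⬝ᵥ Matrix.mulVec H⁻¹ (star ξ)).re := by
  have h := hH.inv.posSemidef.dotProduct_mulVec_nonneg (star ξ)
  rw [star_star] at h
  exact (Complex.le_def.1 h).1

/-- The sub-mean value inequality, up to an error controlled by the curvature, for the squared dual
norm of a holomorphic section. -/
theorem dualNorm_le_circleAverage_add {Ω : Set (Fin n → ℂ)} (hΩ : IsOpen Ω)
    {H : (Fin n → ℂ) → Matrix (Fin r) (Fin r) ℂ} {ξ : (Fin n → ℂ) → Fin r → ℂ}
    {c : (Fin n → ℂ) → ℝ}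
    (hH : ∀ a b, ContDiffOn ℝ 2 (fun w => H w a b) Ω) (hHp : ∀ w ∈ Ω, (H w).PosDef)
    (hξ : ∀ a, ContDiffOn ℂ 2 (fun w => ξ w a) Ω) (hc : ContinuousOn c Ω)
    (hc0 : ∀ z ∈ Ω, 0 ≤ c z)
    (hΘ : ∀ z ∈ Ω, ∀ (v : Fin n → ℂ) (e : Fin r → ℂ),
      -(c z * ‖v‖ ^ 2) * (star e ⬝ᵥ Matrix.mulVec (H z) e).re ≤
        (star e ⬝ᵥ Matrix.mulVec
          (H z * ∑ j, ∑ k, (v j * conj (v k)) • chernCurvature H j k z) e).re)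
    {y w : Fin n → ℂ} (hd : ∀ ζ ∈ Metric.closedBall (0 : ℂ) 1, y + ζ • w ∈ Ω) :
    (ξ y ⬝ᵥ Matrix.mulVec (H y)⁻¹ (star (ξ y))).re ≤
      Real.circleAverage (fun ζ : ℂ => (ξ (y + ζ • w) ⬝ᵥ
        Matrix.mulVec (H (y + ζ • w))⁻¹ (star (ξ (y + ζ • w)))).re) 0 1 +
      ‖w‖ ^ 2 * ∫ τ in (0 : ℝ)..1, Real.circleAverage (fun ζ : ℂ => 4 * c (y + ζ • w) *
        (ξ (y + ζ • w) ⬝ᵥ Matrix.mulVec (H (y + ζ • w))⁻¹ (star (ξ (y + ζ • w)))).re) 0 τ := by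
  have hlineC : ContDiff ℂ 2 (fun ζ : ℂ => y + ζ • w) := by fun_prop
  have hline : ContDiff ℝ 2 (fun ζ : ℂ => y + ζ • w) := hlineC.restrict_scalars ℝ
  set U : Set ℂ := {ζ | y + ζ • w ∈ Ω} with hUdef
  have hU : IsOpen U := hΩ.preimage hline.continuous
  have hψ := contDiffOn_dualNorm hΩ hH hHp fun a => (hξ a).restrict_scalars ℝ
  have hHu : ∀ w ∈ Ω, IsUnit (H w).det := fun w hw =>
    (Matrix.isUnit_iff_isUnit_det _).1 (hHp w hw).isUnit
  have h := le_circleAverage_add_of_planeLaplacian_ge hU hd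
    (φ := fun ζ => (ξ (y + ζ • w) ⬝ᵥ
        Matrix.mulVec (H (y + ζ • w))⁻¹ (star (ξ (y + ζ • w)))).re)
    (κ := fun ζ => ‖w‖ ^ 2 * (4 * c (y + ζ • w) * (ξ (y + ζ • w) ⬝ᵥ
        Matrix.mulVec (H (y + ζ • w))⁻¹ (star (ξ (y + ζ • w)))).re))
    (hψ.comp hline.contDiffOn fun ζ hζ => hζ)
    ?_ ?_ ?_
  · have e : ∀ τ, Real.circleAverage (fun ζ : ℂ => ‖w‖ ^ 2 * (4 * c (y + ζ • w) *
        (ξ (y + ζ • w) ⬝ᵥ Matrix.mulVec (H (y + ζ • w))⁻¹ (star (ξ (y + ζ • w)))).re)) 0 τ =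
        ‖w‖ ^ 2 * Real.circleAverage (fun ζ : ℂ => 4 * c (y + ζ • w) *
        (ξ (y + ζ • w) ⬝ᵥ Matrix.mulVec (H (y + ζ • w))⁻¹ (star (ξ (y + ζ • w)))).re) 0 τ :=
      fun τ => circleAverage_const_mul _ _ _ _
    simpa only [e, intervalIntegral.integral_const_mul, zero_smul, add_zero] using h
  · have h1 := (hc.comp hline.continuous.continuousOn fun ζ (hζ : ζ ∈ Metric.closedBall 0 1) => hd ζ hζ)
    have h2 := (hψ.continuousOn.comp hline.continuous.continuousOn
      fun ζ (hζ : ζ ∈ Metric.closedBall 0 1) => hd ζ hζ)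
    exact ((continuousOn_const (c := (4 : ℝ)).mul h1).mul h2).const_smul (‖w‖ ^ 2)
  · intro ζ hζ
    have := hc0 _ (hd ζ hζ)
    have := dualNorm_nonneg (hHp _ (hd ζ hζ)) (ξ (y + ζ • w))
    positivity
  · intro ζ hζ
    have h1 := planeLaplacian_dual_ge hU (K := fun ζ => H (y + ζ • w)) (ξ := fun ζ => ξ (y + ζ • w))
      (fun a b => (hH a b).comp hline.contDiffOn fun ζ hζ => hζ) (fun ζ hζ => hHp _ hζ)
      (fun a => ((hξ a).comp hlineC.contDiffOn fun ζ hζ => hζ).differentiableOn (by norm_num))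
      (ζ := ζ) (hd ζ hζ) (c := c (y + ζ • w) * ‖w‖ ^ 2) (by
        intro e
        rw [planeWirtingerMat_chern_comp_line hΩ hH hHu (hd ζ hζ)]
        exact hΘ _ (hd ζ hζ) w e)
    refine le_trans (le_of_eq ?_) h1
    ring

end DualNormSubmean

/-! ### Dual norms of hermitian forms -/

namespace SesqForm

open scoped ComplexOrder

variable {V : Type*} [AddCommGroup V] [Module ℂ V]

theorem IsPosDef.normSq_nonneg {h : SesqForm V} (hh : h.IsPosDef) (v : V) : 0 ≤ h.normSq v := by
  by_cases hv : v = 0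
  · simp [normSq, hv]
  · exact (hh.2 v hv).le

/-- The Cauchy-Schwarz inequality. -/
theorem IsPosDef.norm_sq_le {h : SesqForm V} (hh : h.IsPosDef) (v w : V) :
    ‖h v w‖ ^ 2 ≤ h.normSq v * h.normSq w := by
  let c : PreInnerProductSpace.Core ℂ V :=
    { inner := fun v w => h v w
      conj_inner_symm := fun v w => hh.1 w v
      re_inner_nonneg := fun v => hh.normSq_nonneg v
      add_left := fun v w y => by simp
      smul_left := fun v w a => by simp }
  have h1 := InnerProductSpace.Core.inner_mul_inner_self_le (c := c) v w
  have h2 : ‖h w v‖ = ‖h v w‖ := by rw [← hh.1 v w, RCLike.norm_conj]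
  change ‖h v w‖ * ‖h w v‖ ≤ h.normSq v * h.normSq w at h1
  rwa [h2, ← sq] at h1

variable {r : ℕ}

/-- The matrix of a sesquilinear form in a basis. -/
def toMatrix (h : SesqForm V) (φ : (Fin r → ℂ) ≃ₗ[ℂ] V) : Matrix (Fin r) (Fin r) ℂ :=
  Matrix.of fun a b => h (φ (Pi.single a 1)) (φ (Pi.single b 1))

theorem apply_eq_toMatrix (h : SesqForm V) (φ : (Fin r → ℂ) ≃ₗ[ℂ] V) (c d : Fin r → ℂ) :
    h (φ c) (φ d) = star c ⬝ᵥ Matrix.mulVec (h.toMatrix φ) d := by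
  have e : ∀ c : Fin r → ℂ, c = ∑ a, c a • (Pi.single a 1 : Fin r → ℂ) := fun c => by
    simp [← Pi.single_smul, Finset.univ_sum_single]
  conv_lhs => rw [e c, e d]
  simp only [map_sum, map_smul, LinearMap.map_smulₛₗ, LinearMap.sum_apply, LinearMap.smul_apply,
    dotProduct, Matrix.mulVec, toMatrix, Matrix.of_apply, Pi.star_apply, smul_eq_mul,
    Finset.mul_sum]
  rw [Finset.sum_comm]
  exact Finset.sum_congr rfl fun a _ => Finset.sum_congr rfl fun b _ => by
    simp only [starRingEnd_apply]; ring

theorem IsPosDef.posDef_toMatrix {h : SesqForm V} (hh : h.IsPosDef)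
    (φ : (Fin r → ℂ) ≃ₗ[ℂ] V) : (h.toMatrix φ).PosDef := by
  refine Matrix.PosDef.of_dotProduct_mulVec_pos ?_ fun c hc => ?_
  · ext a b
    exact hh.1 _ _
  · rw [← apply_eq_toMatrix]
    have h1 := hh.2 (φ c) (by simpa using hc)
    have h2 : h (φ c) (φ c) = ((h (φ c) (φ c)).re : ℂ) :=
      (Complex.conj_eq_iff_re.1 (hh.1 _ _)).symm
    rw [h2]
    exact_mod_cast h1

/-- A limit of an increasing sequence of positive definite hermitian forms is positive definite. -/
theorem isPosDef_of_tendsto {h : ℕ → SesqForm V} {h' : SesqForm V} (hh : ∀ s, (h s).IsPosDef)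
    (hmono : ∀ s v, (h s).normSq v ≤ (h (s + 1)).normSq v)
    (hlim : ∀ v w, Tendsto (fun s => h s v w) atTop (𝓝 (h' v w))) : h'.IsPosDef := by
  refine ⟨fun v w => ?_, fun v hv => ?_⟩
  · refine tendsto_nhds_unique ((Complex.continuous_conj.tendsto _).comp (hlim v w)) ?_
    simpa only [Function.comp_def, (hh _).1] using hlim w v
  · have h1 : Monotone fun s => (h s).normSq v := monotone_nat_of_le_succ fun s => hmono s v
    exact ((hh 0).2 v hv).trans_le
      (h1.ge_of_tendsto ((Complex.continuous_re.tendsto _).comp (hlim v v)) 0)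

variable [TopologicalSpace V]

/-- The dual norm of a functional is the norm of the vector representing it. -/
theorem IsPosDef.dualNormSq_eq_normSq {h : SesqForm V} (hh : h.IsPosDef) {ξ : V →L[ℂ] ℂ} {v₀ : V}
    (hξ : ∀ v, ξ v = h v₀ v) : h.dualNormSq ξ = h.normSq v₀ := by
  have hle : ∀ v, ‖ξ v‖ ^ 2 / h.normSq v ≤ h.normSq v₀ := fun v =>
    div_le_of_le_mul₀ (hh.normSq_nonneg v) (hh.normSq_nonneg v₀) (hξ v ▸ hh.norm_sq_le v₀ v)
  refine le_antisymm (ciSup_le hle) ?_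
  refine le_ciSup_of_le ⟨_, forall_mem_range.2 hle⟩ v₀ ?_
  have him : h v₀ v₀ = (h.normSq v₀ : ℂ) := (Complex.conj_eq_iff_re.1 (hh.1 v₀ v₀)).symm
  rw [hξ, him, Complex.norm_real, Real.norm_of_nonneg (hh.normSq_nonneg v₀), sq, mul_self_div_self]

theorem IsPosDef.exists_riesz {h : SesqForm V} (hh : h.IsPosDef) (φ : (Fin r → ℂ) ≃ₗ[ℂ] V)
    (ξ : V →L[ℂ] ℂ) (v : V) :
    ξ v = h (φ (Matrix.mulVec (h.toMatrix φ)⁻¹ (star fun a => ξ (φ (Pi.single a 1))))) v := by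
  obtain ⟨c, rfl⟩ := φ.surjective v
  have hp := hh.posDef_toMatrix φ
  have hu : IsUnit (h.toMatrix φ).det := (Matrix.isUnit_iff_isUnit_det _).1 hp.isUnit
  rw [apply_eq_toMatrix, Matrix.star_mulVec, Matrix.conjTranspose_nonsing_inv, hp.isHermitian.eq,
    star_star, ← Matrix.dotProduct_mulVec, Matrix.mulVec_mulVec, Matrix.nonsing_inv_mul _ hu,
    Matrix.one_mulVec]
  have e : c = ∑ a, c a • (Pi.single a 1 : Fin r → ℂ) := by
    simp [← Pi.single_smul, Finset.univ_sum_single]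
  conv_lhs => rw [e]
  simp [dotProduct, map_sum, mul_comm]

theorem IsPosDef.dualNormSq_eq {h : SesqForm V} (hh : h.IsPosDef) (φ : (Fin r → ℂ) ≃ₗ[ℂ] V)
    (ξ : V →L[ℂ] ℂ) :
    h.dualNormSq ξ = ((fun a => ξ (φ (Pi.single a 1))) ⬝ᵥ
      Matrix.mulVec (h.toMatrix φ)⁻¹ (star fun a => ξ (φ (Pi.single a 1)))).re := by
  rw [hh.dualNormSq_eq_normSq (hh.exists_riesz φ ξ), normSq, ← hh.exists_riesz φ ξ]
  congr 1
  set c := Matrix.mulVec (h.toMatrix φ)⁻¹ (star fun a => ξ (φ (Pi.single a 1)))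
  have e : c = ∑ a, c a • (Pi.single a 1 : Fin r → ℂ) := by
    simp [← Pi.single_smul, Finset.univ_sum_single]
  conv_lhs => rw [e]
  simp [dotProduct, map_sum, mul_comm]

theorem dualNormSq_le_of_normSq_le {h h' : SesqForm V} (hh : h.IsPosDef) (hh' : h'.IsPosDef)
    (φ : (Fin r → ℂ) ≃ₗ[ℂ] V) (hle : ∀ v, h.normSq v ≤ h'.normSq v) (ξ : V →L[ℂ] ℂ) :
    h'.dualNormSq ξ ≤ h.dualNormSq ξ := by
  rw [hh.dualNormSq_eq_normSq (hh.exists_riesz φ ξ)]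
  refine ciSup_le fun v => div_le_of_le_mul₀ (hh'.normSq_nonneg v) (hh.normSq_nonneg _) ?_
  rw [hh.exists_riesz φ ξ v]
  exact (hh.norm_sq_le _ v).trans (mul_le_mul_of_nonneg_left (hle v) (hh.normSq_nonneg _))

theorem tendsto_dualNormSq {h : ℕ → SesqForm V} {h' : SesqForm V} (hh : ∀ s, (h s).IsPosDef)
    (hh' : h'.IsPosDef) (φ : (Fin r → ℂ) ≃ₗ[ℂ] V)
    (hlim : ∀ v w, Tendsto (fun s => h s v w) atTop (𝓝 (h' v w))) (ξ : V →L[ℂ] ℂ) :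
    Tendsto (fun s => (h s).dualNormSq ξ) atTop (𝓝 (h'.dualNormSq ξ)) := by
  simp only [(hh _).dualNormSq_eq φ, hh'.dualNormSq_eq φ]
  have h1 : Tendsto (fun s => (h s).toMatrix φ) atTop (𝓝 (h'.toMatrix φ)) :=
    tendsto_pi_nhds.2 fun a => tendsto_pi_nhds.2 fun b => hlim _ _
  have hu : (h'.toMatrix φ).det ≠ 0 :=
    ((Matrix.isUnit_iff_isUnit_det _).1 (hh'.posDef_toMatrix φ).isUnit).ne_zero
  have h2 : ContinuousAt Inv.inv (h'.toMatrix φ) :=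
    continuousAt_matrix_inv _ (by simpa [Ring.inverse_eq_inv'] using continuousAt_inv₀ hu)
  have h3 : Continuous fun A : Matrix (Fin r) (Fin r) ℂ => ((fun a => ξ (φ (Pi.single a 1))) ⬝ᵥ
      Matrix.mulVec A (star fun a => ξ (φ (Pi.single a 1)))).re :=
    Complex.continuous_re.comp (Continuous.dotProduct continuous_const
      (Continuous.matrix_mulVec continuous_id continuous_const))
  exact (h3.tendsto _).comp (h2.tendsto.comp h1)

end SesqForm

/-! ### Local coordinates on the bundle -/

section Coordinates

open scoped ComplexOrder

variable {n r : ℕ} {M : Type*} [TopologicalSpace M] [ChartedSpace (Fin n → ℂ) M]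

theorem IsNullSet.ae_notMem {N : Set M} (hN : IsNullSet n N) (x₀ : M) :
    ∀ᵐ z, z ∈ (chartAt (Fin n → ℂ) x₀).target → (chartAt (Fin n → ℂ) x₀).symm z ∉ N := by
  refine measure_mono_null (fun z hz => ?_) (hN x₀)
  simp only [mem_compl_iff, mem_ofPred_eq, Classical.not_imp, not_not] at hz
  exact ⟨_, ⟨hz.2, (chartAt (Fin n → ℂ) x₀).map_target hz.1⟩,
    (chartAt (Fin n → ℂ) x₀).right_inv hz.1⟩

variable {E : M → Type*} [TopologicalSpace (TotalSpace (Fin r → ℂ) E)]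
  [∀ x, TopologicalSpace (E x)] [FiberBundle (Fin r → ℂ) E]

theorem isOpen_coordDomain {A : Set M} (hA : IsOpen A) (x₀ x₁ : M) :
    IsOpen (coordDomain n r E A x₀ x₁) :=
  (chartAt (Fin n → ℂ) x₀).isOpen_inter_preimage_symm
    (hA.inter (trivializationAt (Fin r → ℂ) E x₁).open_baseSet)

theorem coordDomain_mono {A B : Set M} (hAB : A ⊆ B) (x₀ x₁ : M) :
    coordDomain n r E A x₀ x₁ ⊆ coordDomain n r E B x₀ x₁ :=
  fun _ hz => ⟨hz.1, hAB hz.2.1, hz.2.2⟩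

theorem chartAt_mem_coordDomain {A : Set M} {x x₀ : M} (hx : x ∈ A)
    (hx₀ : x ∈ (chartAt (Fin n → ℂ) x₀).source) :
    chartAt (Fin n → ℂ) x₀ x ∈ coordDomain n r E A x₀ x := by
  refine ⟨(chartAt (Fin n → ℂ) x₀).map_source hx₀, ?_⟩
  rw [mem_preimage, (chartAt (Fin n → ℂ) x₀).left_inv hx₀]
  exact ⟨hx, mem_baseSet_trivializationAt (Fin r → ℂ) E x⟩

theorem continuousOn_chartAt_symm_coordDomain (A : Set M) (x₀ x₁ : M) :
    ContinuousOn (chartAt (Fin n → ℂ) x₀).symm (coordDomain n r E A x₀ x₁) :=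
  (chartAt (Fin n → ℂ) x₀).continuousOn_symm.mono inter_subset_left

variable [∀ x, AddCommGroup (E x)] [∀ x, Module ℂ (E x)] [VectorBundle ℂ (Fin r → ℂ) E]

/-- The identification of `ℂʳ` with the fibre of `E` at `x` given by a trivialization. -/
def frameEquiv (E : M → Type*) [TopologicalSpace (TotalSpace (Fin r → ℂ) E)]
    [∀ x, AddCommGroup (E x)] [∀ x, Module ℂ (E x)] [∀ x, TopologicalSpace (E x)]
    [FiberBundle (Fin r → ℂ) E] [VectorBundle ℂ (Fin r → ℂ) E] {x₁ x : M}
    (hx : x ∈ (trivializationAt (Fin r → ℂ) E x₁).baseSet) : (Fin r → ℂ) ≃ₗ[ℂ] E x :=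
  ((trivializationAt (Fin r → ℂ) E x₁).linearEquivAt ℂ x hx).symm

/-- The coordinates of a section of the dual bundle. -/
def dualCoord (u : ∀ x, E x →L[ℂ] ℂ) (x₀ x₁ : M) (z : Fin n → ℂ) (a : Fin r) : ℂ :=
  u ((chartAt (Fin n → ℂ) x₀).symm z)
    ((trivializationAt (Fin r → ℂ) E x₁).symm ((chartAt (Fin n → ℂ) x₀).symm z) (Pi.single a 1))

theorem dualNormSq_eq_coord {h : ∀ x, SesqForm (E x)} {A : Set M} (hh : ∀ x ∈ A, (h x).IsPosDef)
    (u : ∀ x, E x →L[ℂ] ℂ) {x₀ x₁ : M} {z : Fin n → ℂ} (hz : z ∈ coordDomain n r E A x₀ x₁) :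
    (h ((chartAt (Fin n → ℂ) x₀).symm z)).dualNormSq (u ((chartAt (Fin n → ℂ) x₀).symm z)) =
      (dualCoord (r := r) u x₀ x₁ z ⬝ᵥ
        Matrix.mulVec (localMatrix (r := r) h x₀ x₁ z)⁻¹ (star (dualCoord (r := r) u x₀ x₁ z))).re :=
  (hh _ hz.2.1).dualNormSq_eq (frameEquiv E hz.2.2) _

theorem posDef_localMatrix {h : ∀ x, SesqForm (E x)} {A : Set M} (hh : ∀ x ∈ A, (h x).IsPosDef)
    {x₀ x₁ : M} {z : Fin n → ℂ} (hz : z ∈ coordDomain n r E A x₀ x₁) :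
    (localMatrix (r := r) h x₀ x₁ z).PosDef :=
  (hh _ hz.2.1).posDef_toMatrix (frameEquiv E hz.2.2)

theorem contDiffOn_dualCoord [IsManifold 𝓘(ℂ, Fin n → ℂ) ω M]
    [ContMDiffVectorBundle ω (Fin r → ℂ) E 𝓘(ℂ, Fin n → ℂ)] {u : ∀ x, E x →L[ℂ] ℂ} {U : Set M}
    (hu : IsHolomorphicDualSection n r u U) (x₀ x₁ : M) (a : Fin r) :
    ContDiffOn ℂ ω (fun z => dualCoord (r := r) u x₀ x₁ z a) (coordDomain n r E U x₀ x₁) := by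
  set e := trivializationAt (Fin r → ℂ) E x₁ with he
  have h1 : ContMDiffOn 𝓘(ℂ, Fin n → ℂ) (𝓘(ℂ, Fin n → ℂ).prod 𝓘(ℂ, Fin r → ℂ)) ω
      (fun x => TotalSpace.mk' (Fin r → ℂ) x (e.symm x (Pi.single a 1))) e.baseSet := by
    rw [e.contMDiffOn_section_baseSet_iff]
    refine (contMDiffOn_const (c := (Pi.single a 1 : Fin r → ℂ))).congr fun y hy => ?_
    rw [e.apply_mk_symm hy]
  have h2 : ContMDiffOn 𝓘(ℂ, Fin n → ℂ) (𝓘(ℂ, Fin n → ℂ).prod 𝓘(ℂ, ℂ)) ω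
      (fun x => TotalSpace.mk' ℂ (E := Trivial M ℂ) x (u x (e.symm x (Pi.single a 1))))
      (U ∩ e.baseSet) :=
    ContMDiffOn.clm_bundle_apply (E₂ := Trivial M ℂ) (b := fun x => x)
      (hu.mono inter_subset_left) (h1.mono inter_subset_right)
  have h3 : ContMDiffOn 𝓘(ℂ, Fin n → ℂ) 𝓘(ℂ, ℂ) ω
      (fun x => u x (e.symm x (Pi.single a 1))) (U ∩ e.baseSet) := by
    intro x hx
    exact (contMDiffWithinAt_totalSpace.1 (h2 x hx)).2
  have h4 : ContMDiffOn 𝓘(ℂ, Fin n → ℂ) 𝓘(ℂ, Fin n → ℂ) ω (chartAt (Fin n → ℂ) x₀).symm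
      (coordDomain n r E U x₀ x₁) := contMDiffOn_chart_symm.mono inter_subset_left
  exact (h3.comp h4 fun z hz => hz.2).contDiffOn

/-- Nakano semi-positivity up to `λ g` implies Griffiths semi-positivity up to a multiple of
`λ`. -/
theorem NakanoGE.griffiths [IsManifold 𝓘(ℂ, Fin n → ℂ) ω M] {h : ∀ x, SesqForm (E x)}
    {g : ∀ x : M, SesqForm (TangentSpace 𝓘(ℂ, Fin n → ℂ) x)} {lam : M → ℝ} {A : Set M}
    (hN : NakanoGE n r h (fun x => 0 - (lam x : ℂ) • g x) A) (hh : ∀ x ∈ A, (h x).IsPosDef)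
    (hlam : ∀ x ∈ A, 0 ≤ lam x) {x₀ x₁ : M} {z : Fin n → ℂ} (hz : z ∈ coordDomain n r E A x₀ x₁)
    (v : Fin n → ℂ) (e : Fin r → ℂ) :
    -(lam ((chartAt (Fin n → ℂ) x₀).symm z) * (∑ j, ∑ k, ‖localMatrix (r := n)
        (E := TangentSpace 𝓘(ℂ, Fin n → ℂ)) g x₀ x₀ z k j‖) * ‖v‖ ^ 2) *
        (star e ⬝ᵥ Matrix.mulVec (localMatrix (r := r) h x₀ x₁ z) e).re ≤
      (star e ⬝ᵥ Matrix.mulVec (localMatrix (r := r) h x₀ x₁ z *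
        ∑ j, ∑ k, (v j * conj (v k)) • chernCurvature (localMatrix (r := r) h x₀ x₁) j k z) e).re := by
  set H := localMatrix (r := r) h x₀ x₁ z with hH
  set l := lam ((chartAt (Fin n → ℂ) x₀).symm z) with hl
  set G := localMatrix (r := n) (E := TangentSpace 𝓘(ℂ, Fin n → ℂ)) g x₀ x₀ z with hG
  have hl0 : 0 ≤ l := hlam _ hz.2.1
  have hq0 := (posDef_localMatrix (r := r) hh hz).posSemidef.dotProduct_mulVec_nonneg e
  rw [Complex.le_def] at hq0
  set q := star e ⬝ᵥ Matrix.mulVec H e with hq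
  have hqr : q = (q.re : ℂ) := Complex.ext (by simp) (by simpa using hq0.2.symm)
  have key := hN x₀ x₁ z hz fun j => v j • e
  have hstar : ∀ (k : Fin n) (B : Matrix (Fin r) (Fin r) ℂ) (j : Fin n),
      star (v k • e) ⬝ᵥ Matrix.mulVec B (v j • e) =
        v j * conj (v k) * (star e ⬝ᵥ Matrix.mulVec B e) := by
    intro k B j
    rw [star_smul, Matrix.mulVec_smul, smul_dotProduct, dotProduct_smul, smul_eq_mul, smul_eq_mul,
      ← mul_assoc, mul_comm (v j)]
    rfl
  have hloc : ∀ k j, localMatrix (r := n) (E := TangentSpace 𝓘(ℂ, Fin n → ℂ))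
      (fun x => 0 - (lam x : ℂ) • g x) x₀ x₀ z k j = -(l * G k j) := by
    intro k j
    simp [localMatrix, hG, hl]
  simp only [hstar, hloc] at key
  have hrhs : ∑ j, ∑ k, v j * conj (v k) *
      (star e ⬝ᵥ Matrix.mulVec (H * chernCurvature (localMatrix (r := r) h x₀ x₁) j k z) e) =
      star e ⬝ᵥ Matrix.mulVec (H *
        ∑ j, ∑ k, (v j * conj (v k)) • chernCurvature (localMatrix (r := r) h x₀ x₁) j k z) e := by
    simp only [Finset.mul_sum, Matrix.mul_smul, Matrix.sum_mulVec, dotProduct_sum,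
      Matrix.smul_mulVec, dotProduct_smul, smul_eq_mul]
  rw [hrhs] at key
  refine le_trans ?_ key
  rw [← hq, hqr, Complex.ofReal_re]
  simp only [← mul_assoc, ← Finset.sum_mul, Complex.re_mul_ofReal]
  refine mul_le_mul_of_nonneg_right ?_ (by simpa using hq0.1)
  rw [neg_le, ← Complex.neg_re, ← Finset.sum_neg_distrib]
  refine (Complex.re_le_norm _).trans ((norm_sum_le _ _).trans ?_)
  rw [mul_assoc, Finset.sum_mul, Finset.mul_sum]
  refine Finset.sum_le_sum fun j _ => ?_
  rw [← Finset.sum_neg_distrib, Finset.sum_mul, Finset.mul_sum]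
  refine (norm_sum_le _ _).trans (Finset.sum_le_sum fun k _ => ?_)
  have h1 : ‖v j‖ * ‖v k‖ ≤ ‖v‖ ^ 2 := by
    rw [sq]
    exact mul_le_mul (norm_le_pi_norm v j) (norm_le_pi_norm v k) (norm_nonneg _) (norm_nonneg _)
  have h2 : ‖-(-(↑l * G k j) * v j * conj (v k))‖ = l * ‖G k j‖ * (‖v j‖ * ‖v k‖) := by
    simp only [norm_neg, norm_mul, RCLike.norm_conj, Complex.norm_real, Real.norm_of_nonneg hl0]
    ring
  rw [h2, ← mul_assoc l]
  exact mul_le_mul_of_nonneg_left h1 (mul_nonneg hl0 (norm_nonneg _))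

end Coordinates

/-! ### Dual norms for singular hermitian metrics -/

section Main

namespace SingularHermitianMetric

variable {n r : ℕ} {M : Type*} [TopologicalSpace M]
  [ChartedSpace (Fin n → ℂ) M]
  {E : M → Type*} [TopologicalSpace (TotalSpace (Fin r → ℂ) E)]
  [∀ x, AddCommGroup (E x)] [∀ x, Module ℂ (E x)] [∀ x, TopologicalSpace (E x)]
  [FiberBundle (Fin r → ℂ) E]

theorem dualNormSq_approx_nonneg (S : SingularHermitianMetric n r E) {j : ℕ} {x : M}
    (hx : x ∈ S.exh j) (s : ℕ) (ξ : E x →L[ℂ] ℂ) : 0 ≤ (S.approx j s x).dualNormSq ξ := by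
  have h := (S.approx_metric j s).1 x hx
  exact Real.iSup_nonneg fun v => div_nonneg (sq_nonneg _) (h.normSq_nonneg v)

variable [IsManifold 𝓘(ℂ, Fin n → ℂ) ω M] {S : SingularHermitianMetric n r E}
  {g : ∀ x : M, SesqForm (TangentSpace 𝓘(ℂ, Fin n → ℂ) x)}

theorem IsNakanoSemipositive.normSq_approx_le (hNak : S.IsNakanoSemipositive g) {j : ℕ} {x : M}
    (hx : x ∈ S.exh j) (s : ℕ) (e : E x) :
    (S.approx j s x).normSq e ≤ (S.approx j (s + 1) x).normSq e := by
  obtain ⟨-, -, -, -, h, -⟩ := hNak j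
  exact h x hx s e

theorem IsNakanoSemipositive.isPosDef_metric (hNak : S.IsNakanoSemipositive g) {j : ℕ} {x : M}
    (hx : x ∈ S.exh j)
    (hlim : ∀ v w, Tendsto (fun s => S.approx j s x v w) atTop (𝓝 (S.metric x v w))) :
    (S.metric x).IsPosDef :=
  SesqForm.isPosDef_of_tendsto (fun s => (S.approx_metric j s).1 x hx)
    (fun s => hNak.normSq_approx_le hx s) hlim

variable [VectorBundle ℂ (Fin r → ℂ) E]

theorem IsNakanoSemipositive.antitone_dualNormSq (hNak : S.IsNakanoSemipositive g) {j : ℕ} {x : M}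
    (hx : x ∈ S.exh j) (ξ : E x →L[ℂ] ℂ) :
    Antitone fun s => (S.approx j s x).dualNormSq ξ :=
  antitone_nat_of_succ_le fun s => SesqForm.dualNormSq_le_of_normSq_le
    ((S.approx_metric j s).1 x hx) ((S.approx_metric j (s + 1)).1 x hx)
    (frameEquiv E (mem_baseSet_trivializationAt (Fin r → ℂ) E x))
    (hNak.normSq_approx_le hx s) ξ

theorem IsNakanoSemipositive.tendsto_dualNormSq_metric (hNak : S.IsNakanoSemipositive g) {j : ℕ}
    {x : M} (hx : x ∈ S.exh j)
    (hlim : ∀ v w, Tendsto (fun s => S.approx j s x v w) atTop (𝓝 (S.metric x v w)))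
    (ξ : E x →L[ℂ] ℂ) :
    Tendsto (fun s => (S.approx j s x).dualNormSq ξ) atTop (𝓝 ((S.metric x).dualNormSq ξ)) :=
  SesqForm.tendsto_dualNormSq (fun s => (S.approx_metric j s).1 x hx)
    (hNak.isPosDef_metric hx hlim)
    (frameEquiv E (mem_baseSet_trivializationAt (Fin r → ℂ) E x)) hlim ξ

variable [ContMDiffVectorBundle ω (Fin r → ℂ) E 𝓘(ℂ, Fin n → ℂ)]
  {u : ∀ x, E x →L[ℂ] ℂ} {U : Set M}

theorem contDiffOn_dualNormSq_approx (S : SingularHermitianMetric n r E) (hU : IsOpen U)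
    (hu : IsHolomorphicDualSection n r u U) (j s : ℕ) (x₀ x₁ : M) :
    ContDiffOn ℝ 2 (fun z => (S.approx j s ((chartAt (Fin n → ℂ) x₀).symm z)).dualNormSq
      (u ((chartAt (Fin n → ℂ) x₀).symm z))) (coordDomain n r E (U ∩ S.exh j) x₀ x₁) := by
  have hsub : coordDomain n r E (U ∩ S.exh j) x₀ x₁ ⊆ coordDomain n r E (S.exh j) x₀ x₁ :=
    coordDomain_mono inter_subset_right x₀ x₁
  have h := contDiffOn_dualNorm (isOpen_coordDomain (hU.inter (S.isOpen_exh j)) x₀ x₁)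
    (fun a b => ((S.approx_metric j s).2 x₀ x₁ a b).mono hsub)
    (fun z hz => posDef_localMatrix (S.approx_metric j s).1 (hsub hz))
    (fun a => (((contDiffOn_dualCoord hu x₀ x₁ a).mono
      (coordDomain_mono inter_subset_left x₀ x₁)).of_le le_top).restrict_scalars ℝ)
  exact h.congr fun z hz => dualNormSq_eq_coord (S.approx_metric j s).1 u (hsub hz)

/-- In local coordinates, the limit of the squared dual norms of a holomorphic section is the limit
of its averages over balls and satisfies the sub-mean value inequality. -/
theorem IsNakanoSemipositive.submean (hNak : S.IsNakanoSemipositive g)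
    (hg : IsHermitianMetricOn n n (E := TangentSpace 𝓘(ℂ, Fin n → ℂ)) ∞ g univ)
    (hU : IsOpen U) (hu : IsHolomorphicDualSection n r u U) {j : ℕ} {f : M → ℝ}
    (hf : ∀ x ∈ U ∩ S.exh j,
      Tendsto (fun s => (S.approx j s x).dualNormSq (u x)) atTop (𝓝 (f x)))
    {x₀ x₁ : M} {z : Fin n → ℂ} (hz : z ∈ coordDomain n r E (U ∩ S.exh j) x₀ x₁) :
    Tendsto (fun ε => (∫ y in Metric.ball z ε, f ((chartAt (Fin n → ℂ) x₀).symm y)) /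
      (volume : Measure (Fin n → ℂ)).real (Metric.ball z ε)) (𝓝[>] 0)
      (𝓝 (f ((chartAt (Fin n → ℂ) x₀).symm z))) ∧
    ∀ v : Fin n → ℂ, ∀ᶠ ρ : ℝ in 𝓝[>] 0,
      CircleIntegrable (fun ζ : ℂ => f ((chartAt (Fin n → ℂ) x₀).symm (z + ζ • v))) 0 ρ ∧
      f ((chartAt (Fin n → ℂ) x₀).symm z) ≤
        Real.circleAverage (fun ζ : ℂ => f ((chartAt (Fin n → ℂ) x₀).symm (z + ζ • v))) 0 ρ := by
  obtain ⟨lam, lamBd, hlamc, hBdc, -, hN, hnull, hlam⟩ := hNak j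
  set χ := (chartAt (Fin n → ℂ) x₀).symm with hχ
  set Ω := coordDomain n r E (U ∩ S.exh j) x₀ x₁ with hΩdef
  have hΩ : IsOpen Ω := isOpen_coordDomain (hU.inter (S.isOpen_exh j)) x₀ x₁
  have hsub : Ω ⊆ coordDomain n r E (S.exh j) x₀ x₁ := coordDomain_mono inter_subset_right x₀ x₁
  have hχc : ContinuousOn χ Ω := continuousOn_chartAt_symm_coordDomain _ x₀ x₁
  have hcl : MapsTo χ Ω (closure (S.exh j)) := fun y hy => subset_closure hy.2.1.2
  set G : (Fin n → ℂ) → ℝ := fun y => ∑ j, ∑ k, ‖localMatrix (r := n)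
    (E := TangentSpace 𝓘(ℂ, Fin n → ℂ)) g x₀ x₀ y k j‖ with hG
  have hGc : ContinuousOn G Ω := by
    refine continuousOn_finsetSum _ fun j _ => continuousOn_finsetSum _ fun k _ => ?_
    refine ((hg.2 x₀ x₀ k j).continuousOn.mono fun y hy => ?_).norm
    refine ⟨hy.1, trivial, ?_⟩
    rw [TangentBundle.trivializationAt_baseSet]
    exact (chartAt (Fin n → ℂ) x₀).map_target hy.1
  have hG0 : ∀ y, 0 ≤ G y := fun y =>
    Finset.sum_nonneg fun j _ => Finset.sum_nonneg fun k _ => norm_nonneg _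
  set ψ : ℕ → (Fin n → ℂ) → ℝ := fun s y => (S.approx j s (χ y)).dualNormSq (u (χ y)) with hψ
  have hψc : ∀ s, ContinuousOn (ψ s) Ω := fun s =>
    (S.contDiffOn_dualNormSq_approx hU hu j s x₀ x₁).continuousOn
  have hψ0 : ∀ s, ∀ y ∈ Ω, 0 ≤ ψ s y := fun s y hy => S.dualNormSq_approx_nonneg hy.2.1.2 s _
  have hanti : ∀ y ∈ Ω, Antitone fun s => ψ s y := fun y hy =>
    hNak.antitone_dualNormSq hy.2.1.2 _
  have hlim : ∀ y ∈ Ω, Tendsto (fun s => ψ s y) atTop (𝓝 (f (χ y))) := fun y hy => hf _ hy.2.1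
  have hlc : ∀ s, ContinuousOn (fun y => lam s (χ y)) Ω := fun s => (hlamc s).comp hχc hcl
  have hl0 : ∀ s, ∀ y ∈ Ω, 0 ≤ lam s (χ y) := fun s y hy => (hlam s _ hy.2.1.2).1
  refine submean_of_antitone_limit hΩ (ψ := ψ) (b := fun s y => 4 * (lam s (χ y) * G y) * ψ s y)
    (f := fun y => f (χ y)) (B := fun y => 4 * (lamBd (χ y) * G y) * ψ 0 y) hψc hψ0 hanti
    ?_ ?_ ?_ ?_ ?_ ?_ hlim hz
  · exact fun s => (continuousOn_const.mul ((hlc s).mul hGc)).mul (hψc s)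
  · intro s y hy
    have := hl0 s y hy
    have := hG0 y
    have := hψ0 s y hy
    positivity
  · exact (continuousOn_const.mul ((hBdc.comp hχc hcl).mul hGc)).mul (hψc 0)
  · intro s y hy
    have h1 := hl0 s y hy
    have h2 := hG0 y
    have h3 := (hlam s _ hy.2.1.2).2
    refine mul_le_mul ?_ (hanti y hy (Nat.zero_le s)) (hψ0 s y hy) ?_
    · exact mul_le_mul_of_nonneg_left (mul_le_mul_of_nonneg_right h3 h2) (by norm_num)
    · have := h1.trans h3
      positivity
  · filter_upwards [hnull.ae_notMem x₀] with y hy hyΩ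
    have h1 : Tendsto (fun s => lam s (χ y)) atTop (𝓝 0) := by
      by_contra hcon
      exact hy hyΩ.1 ⟨hyΩ.2.1.2, hcon⟩
    have h2 := ((h1.mul_const (G y)).const_mul 4).mul (hlim y hyΩ)
    simpa using h2
  · intro s y w hd
    have hyΩ : y ∈ Ω := by simpa using hd 0 (by simp)
    have hcoord : ∀ y ∈ Ω, ψ s y = (dualCoord u x₀ x₁ y ⬝ᵥ Matrix.mulVec
        (localMatrix (r := r) (S.approx j s) x₀ x₁ y)⁻¹ (star (dualCoord u x₀ x₁ y))).re :=
      fun y hy => dualNormSq_eq_coord (S.approx_metric j s).1 u (hsub hy)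
    have h := dualNorm_le_circleAverage_add hΩ
      (fun a b => ((S.approx_metric j s).2 x₀ x₁ a b).mono hsub)
      (fun y hy => posDef_localMatrix (S.approx_metric j s).1 (hsub hy))
      (fun a => ((contDiffOn_dualCoord hu x₀ x₁ a).mono
        (coordDomain_mono inter_subset_left x₀ x₁)).of_le le_top)
      ((hlc s).mul hGc) (fun y hy => mul_nonneg (hl0 s y hy) (hG0 y))
      (fun y hy v e => NakanoGE.griffiths (hN s) (S.approx_metric j s).1
        (fun x hx => (hlam s x hx).1) (hsub hy) v e) hd
    rw [← hcoord y hyΩ] at h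
    refine h.trans_eq ?_
    congr 1
    · refine Real.circleAverage_congr_sphere fun ζ hζ => ?_
      exact (hcoord _ (hd ζ (Metric.sphere_subset_closedBall (by simpa using hζ)))).symm
    · congr 1
      refine intervalIntegral.integral_congr fun τ hτ => ?_
      rw [uIcc_of_le zero_le_one] at hτ
      refine Real.circleAverage_congr_sphere fun ζ hζ => ?_
      have hζ' : ζ ∈ Metric.closedBall (0 : ℂ) 1 := by
        rw [mem_sphere_zero_iff_norm, abs_of_nonneg hτ.1] at hζ
        rw [mem_closedBall_zero_iff, hζ]
        exact hτ.2
      simp only [hcoord _ (hd ζ hζ'), Pi.mul_apply]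

/-- The limit of the squared dual norms does not depend on the member of the exhaustion. -/
theorem IsNakanoSemipositive.limit_unique (hNak : S.IsNakanoSemipositive g)
    (hg : IsHermitianMetricOn n n (E := TangentSpace 𝓘(ℂ, Fin n → ℂ)) ∞ g univ)
    (hU : IsOpen U) (hu : IsHolomorphicDualSection n r u U) {i j : ℕ} {f f' : M → ℝ}
    (hf : ∀ x ∈ U ∩ S.exh i,
      Tendsto (fun s => (S.approx i s x).dualNormSq (u x)) atTop (𝓝 (f x)))
    (hf' : ∀ x ∈ U ∩ S.exh j,
      Tendsto (fun s => (S.approx j s x).dualNormSq (u x)) atTop (𝓝 (f' x)))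
    {x : M} (hxU : x ∈ U) (hi : x ∈ S.exh i) (hj : x ∈ S.exh j) : f x = f' x := by
  have hx : x ∈ (chartAt (Fin n → ℂ) x).source := mem_chart_source _ x
  set z := chartAt (Fin n → ℂ) x x with hz
  have hzi : z ∈ coordDomain n r E (U ∩ S.exh i) x x := chartAt_mem_coordDomain ⟨hxU, hi⟩ hx
  have hzj : z ∈ coordDomain n r E (U ∩ S.exh j) x x := chartAt_mem_coordDomain ⟨hxU, hj⟩ hx
  have h1 := (hNak.submean hg hU hu hf hzi).1
  have h2 := (hNak.submean hg hU hu hf' hzj).1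
  rw [hz, (chartAt (Fin n → ℂ) x).left_inv hx] at h1 h2
  refine tendsto_nhds_unique (h1.congr' ?_) h2
  obtain ⟨R, hR, hRΩ⟩ := Metric.nhds_basis_ball.mem_iff.1 (inter_mem
    ((isOpen_coordDomain (hU.inter (S.isOpen_exh i)) x x).mem_nhds hzi)
    ((isOpen_coordDomain (hU.inter (S.isOpen_exh j)) x x).mem_nhds hzj))
  filter_upwards [Ioo_mem_nhdsGT hR] with ε hε
  congr 1
  refine setIntegral_congr_ae measurableSet_ball ?_
  filter_upwards [S.sing_null.ae_notMem x] with y hy hyε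
  obtain ⟨hyi, hyj⟩ := hRΩ (Metric.ball_subset_ball hε.2.le hyε)
  have hs := hy hyi.1
  have e1 := tendsto_nhds_unique (hf _ hyi.2.1) (hNak.tendsto_dualNormSq_metric hyi.2.1.2
    (S.tendsto_approx i _ ⟨hyi.2.1.2, hs⟩) _)
  have e2 := tendsto_nhds_unique (hf' _ hyj.2.1) (hNak.tendsto_dualNormSq_metric hyj.2.1.2
    (S.tendsto_approx j _ ⟨hyj.2.1.2, hs⟩) _)
  rw [e1, e2]

theorem IsNakanoSemipositive.isPlurisubharmonicOn (hNak : S.IsNakanoSemipositive g)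
    (hg : IsHermitianMetricOn n n (E := TangentSpace 𝓘(ℂ, Fin n → ℂ)) ∞ g univ)
    (hU : IsOpen U) (hu : IsHolomorphicDualSection n r u U) {f : M → ℝ}
    (hf : ∀ j, ∀ x ∈ U ∩ S.exh j,
      Tendsto (fun s => (S.approx j s x).dualNormSq (u x)) atTop (𝓝 (f x))) :
    IsPlurisubharmonicOn n f U := by
  have hex : ∀ x, ∃ j, x ∈ S.exh j := fun x => mem_iUnion.1 (S.iUnion_exh ▸ mem_univ x)
  constructor
  · intro x hxU a ha
    obtain ⟨j, hj⟩ := hex x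
    obtain ⟨s, hs⟩ := ((hf j x ⟨hxU, hj⟩).eventually (gt_mem_nhds ha)).exists
    have hx : x ∈ (chartAt (Fin n → ℂ) x).source := mem_chart_source _ x
    have hz : chartAt (Fin n → ℂ) x x ∈ coordDomain n r E (U ∩ S.exh j) x x :=
      chartAt_mem_coordDomain ⟨hxU, hj⟩ hx
    have hc := (S.contDiffOn_dualNormSq_approx hU hu j s x x).continuousOn.continuousAt
      ((isOpen_coordDomain (hU.inter (S.isOpen_exh j)) x x).mem_nhds hz)
    have hc2 := hc.comp ((chartAt (Fin n → ℂ) x).continuousAt hx)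
    have key : ∀ y ∈ (chartAt (Fin n → ℂ) x).source,
        (S.approx j s ((chartAt (Fin n → ℂ) x).symm (chartAt (Fin n → ℂ) x y))).dualNormSq
          (u ((chartAt (Fin n → ℂ) x).symm (chartAt (Fin n → ℂ) x y))) =
          (S.approx j s y).dualNormSq (u y) := fun y hy =>
      congrArg (fun y => (S.approx j s y).dualNormSq (u y))
        ((chartAt (Fin n → ℂ) x).left_inv hy)
    have hev := hc2.eventually (gt_mem_nhds (a := a) ((key x hx).trans_lt hs))
    refine nhdsWithin_le_nhds ?_
    filter_upwards [hev, (chartAt (Fin n → ℂ) x).open_source.mem_nhds hx,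
      (hU.inter (S.isOpen_exh j)).mem_nhds ⟨hxU, hj⟩] with y hy hys hyU
    exact ((hNak.antitone_dualNormSq hyU.2 (u y)).le_of_tendsto (hf j y hyU) s).trans_lt
      ((key y hys).symm.trans_lt hy)
  · intro x₀ x hx v
    obtain ⟨j, hj⟩ := hex x
    have hz : chartAt (Fin n → ℂ) x₀ x ∈ coordDomain n r E (U ∩ S.exh j) x₀ x :=
      chartAt_mem_coordDomain ⟨hx.1, hj⟩ hx.2
    have h := (hNak.submean hg hU hu (hf j) hz).2 v
    rwa [(chartAt (Fin n → ℂ) x₀).left_inv hx.2] at h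

/-- The squared dual norms of a holomorphic section for the approximating metrics converge, with a
limit independent of the member of the exhaustion. -/
theorem IsNakanoSemipositive.exists_limit (hNak : S.IsNakanoSemipositive g)
    (hg : IsHermitianMetricOn n n (E := TangentSpace 𝓘(ℂ, Fin n → ℂ)) ∞ g univ)
    (hU : IsOpen U) (hu : IsHolomorphicDualSection n r u U) :
    ∃ f : M → ℝ, ∀ j, ∀ x ∈ U ∩ S.exh j,
      Tendsto (fun s => (S.approx j s x).dualNormSq (u x)) atTop (𝓝 (f x)) := by
  have hex : ∀ x, ∃ j, x ∈ S.exh j := fun x => mem_iUnion.1 (S.iUnion_exh ▸ mem_univ x)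
  choose i hi using hex
  have hlim : ∀ j, ∀ x ∈ U ∩ S.exh j, Tendsto (fun s => (S.approx j s x).dualNormSq (u x)) atTop
      (𝓝 (⨅ s, (S.approx j s x).dualNormSq (u x))) := fun j x hx =>
    tendsto_atTop_ciInf (hNak.antitone_dualNormSq hx.2 (u x))
      ⟨0, forall_mem_range.2 fun s => S.dualNormSq_approx_nonneg hx.2 s (u x)⟩
  refine ⟨fun x => ⨅ s, (S.approx (i x) s x).dualNormSq (u x), fun j x hx => ?_⟩
  have h : ⨅ s, (S.approx j s x).dualNormSq (u x) = ⨅ s, (S.approx (i x) s x).dualNormSq (u x) :=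
    hNak.limit_unique hg hU hu (hlim j) (hlim (i x)) hx.1 hx.2 (hi x)
  have hj := hlim j x hx
  rwa [h] at hj

end SingularHermitianMetric

end Main

theorem mainTheorem8 {n r : ℕ} {M : Type*} [TopologicalSpace M] [T2Space M]
    [ChartedSpace (Fin n → ℂ) M] [IsManifold 𝓘(ℂ, Fin n → ℂ) ω M]
    {E : M → Type*} [TopologicalSpace (TotalSpace (Fin r → ℂ) E)]
    [∀ x, AddCommGroup (E x)] [∀ x, Module ℂ (E x)] [∀ x, TopologicalSpace (E x)]
    [FiberBundle (Fin r → ℂ) E] [VectorBundle ℂ (Fin r → ℂ) E]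
    [ContMDiffVectorBundle ω (Fin r → ℂ) E 𝓘(ℂ, Fin n → ℂ)]
    (S : SingularHermitianMetric n r E)
    (g : ∀ x : M, SesqForm (TangentSpace 𝓘(ℂ, Fin n → ℂ) x))
    (hg : IsHermitianMetricOn n n (E := TangentSpace 𝓘(ℂ, Fin n → ℂ)) ∞ g univ)
    (hNak : S.IsNakanoSemipositive g) :
    -- `h` is Griffiths semi-positive if the metrics `h_{j,s}` converge to `h` on `Σ` as well
    ((∀ x ∈ S.sing, ∃ j, x ∈ S.exh j ∧ ∀ v w : E x,
        Tendsto (fun s => S.approx j s x v w) atTop (𝓝 (S.metric x v w))) →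
      IsGriffithsSemipositive n r S.metric) ∧
    -- in general `|u|²_{h*}` extends from the complement of `Σ` to a plurisubharmonic function,
    -- which is everywhere the limit of `|u|²` for the duals of the `h_{j,s}`
    (∀ U : Set M, IsOpen U → ∀ u : ∀ x, E x →L[ℂ] ℂ, IsHolomorphicDualSection n r u U →
      ∃ f : M → ℝ, IsPlurisubharmonicOn n f U ∧
        (∀ x ∈ U \ S.sing, f x = (S.metric x).dualNormSq (u x)) ∧
        ∀ j, ∀ x ∈ U ∩ S.exh j,
          Tendsto (fun s => (S.approx j s x).dualNormSq (u x)) atTop (𝓝 (f x))) := by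
  have hex : ∀ x, ∃ j, x ∈ S.exh j := fun x => mem_iUnion.1 (S.iUnion_exh ▸ mem_univ x)
  constructor
  · intro hsing
    have hconv : ∀ x, ∃ j, x ∈ S.exh j ∧ ∀ v w : E x,
        Tendsto (fun s => S.approx j s x v w) atTop (𝓝 (S.metric x v w)) := by
      intro x
      by_cases hx : x ∈ S.sing
      · exact hsing x hx
      · obtain ⟨j, hj⟩ := hex x
        exact ⟨j, hj, S.tendsto_approx j x ⟨hj, hx⟩⟩
    refine ⟨S.measurable_metric, fun x => ?_, fun U hU u hu => ?_⟩
    · obtain ⟨j, hj, hlim⟩ := hconv x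
      exact hNak.isPosDef_metric hj hlim
    · obtain ⟨f, hf⟩ := hNak.exists_limit hg hU hu
      refine hNak.isPlurisubharmonicOn hg hU hu fun j x hx => ?_
      obtain ⟨i, hi, hlim⟩ := hconv x
      rw [← tendsto_nhds_unique (hf i x ⟨hx.1, hi⟩)
        (hNak.tendsto_dualNormSq_metric hi hlim (u x))]
      exact hf j x hx
  · intro U hU u hu
    obtain ⟨f, hf⟩ := hNak.exists_limit hg hU hu
    refine ⟨f, hNak.isPlurisubharmonicOn hg hU hu hf, fun x hx => ?_, hf⟩
    obtain ⟨j, hj⟩ := hex x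
    exact tendsto_nhds_unique (hf j x ⟨hx.1, hj⟩)
      (hNak.tendsto_dualNormSq_metric hj (S.tendsto_approx j x ⟨hj, hx.2⟩) (u x))
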